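/- **Setting.** Fix $d,r\ge 1$ and $I_1,\dots,I_d\in\mathbb N$. A $d$-mode tensor in rank-$r$ CP form, $\mathscr X=\sum_{k=1}^r \mathbf x_k^{(1)}\otimes\cdots\otimes\mathbf x_k^{(d)}$, is represented by its factors $\mathbf x_k^{(j)}\in\mathbb R^{I_j}$. Let $\mu$ be the law of $(\mathscr X,y)$ with $y\in\{-1,1\}$ and $\|\mathbf x_k^{(j)}\|^2\le B_x<\infty$ almost surely, and let $T_n=\{(\mathscr X_i,y_i)\}_{i\le n}$ be i.i.d. from $\mu$. *Kernel.* For each mode $j$ let $K^{(j)}(a,b)=h^{(j)}(\|a-b\|^2)$ or $K^{(j)}(a,b)=h^{(j)}(\langle a,b\rangle)$ be positive semidefinite on $\mathbb R^m$ for every $m$, with $h^{(j)}$ Lipschitz (on $[0,\infty)$, respectively on $\mathbb R$). Put $K(\mathscr X,\mathscr Y)=\sum_{k,l=1}^r\prod_{j=1}^d K^{(j)}(\mathbf x_k^{(j)},\mathbf y_l^{(j)})$ for CP tensors of equal, arbitrary mode sizes, and assume $K\le K_{\max}^2<\infty$. *Loss and risk.* Let $L$ be the hinge loss $L(y,t)=\max(0,1-yt)$,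 with $q=1$, or the squared hinge loss $L(y,t)=\max(0,1-yt)^2$, with $q=3/2$. Let $\mathcal R(f)=\mathbb E\,L(y,f(\mathscr X))$ and let $\mathcal R^*$ be the infimum of $\mathcal R$ over all measurable $f$. With $\mathcal F$ the reproducing kernel Hilbert space (RKHS) of $K$ on the CP tensors of mode sizes $I_1,\dots,I_d$, assume that for some $c_\eta$ and $0<\eta\le 1$, $$D(\lambda)=\inf_{f\in\mathcal F}\{\mathcal R(f)-\mathcal R^*+\lambda\|f\|_K^2\}\le c_\eta\lambda^\eta\qquad\text{for all }\lambda>0 .$$ *Projection.* For each $n$ let $\mathbf A^{(j)}\in\mathbb R^{P_j(n)\times I_j}$, $j=1,\dots,d$, have independent $\mathcal N(0,1)$ entries, independent of $T_n$. The projected tensor $\mathscr A\circ\mathscr X$ has the factors $P_j(n)^{-1/2}\mathbf A^{(j)}\mathbf x_k^{(j)}$. *Parameters.* Let $\lambda_n>0$, $\varepsilon_n>0$ and $\delta_1\in(0,1)$ satisfy $\lambda_n\to0$, $n\lambda_n^2\to\infty$, $\varepsilon_n/\lambda_n^{q}\to0$, and let $P_j(n)$ be at least of the order $\varepsilon_n^{-2}[\log(n/\delta_1)]^{1/d}$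 for each $j$, that is, $\varepsilon_n^{-2}[\log(n/\delta_1)]^{1/d}=O(P_j(n))$ as $n\to\infty$ (for instance $P_j(n)=\lceil 3r^{2/d}\varepsilon_n^{-2}[\log(n/\delta_1)]^{1/d}\rceil+1$). *Classifiers.* RPSTM is $g_n^\lambda(\mathscr X)=\hat g(\mathscr A\circ\mathscr X)$, where $\hat g$ minimizes $\frac1n\sum_{i=1}^n L(y_i,g(\mathscr A\circ\mathscr X_i))+\lambda_n\|g\|_K^2$ over the RKHS of $K$ on the CP tensors of mode sizes $P_1(n),\dots,P_d(n)$. For $b\ge1$ and $\gamma\in(-1,1)$, TEC is $e_{n,b}(\mathscr X)=1$ if $\frac1b\sum_{m=1}^b\operatorname{Sign}(g_{n,m}^\lambda(\mathscr X))\ge\gamma$ and $-1$ otherwise, where $g_{n,1}^\lambda,\dots,g_{n,b}^\lambda$ are the RPSTMs trained on $T_n$ with $b$ independent projections $\mathscr A_1,\dots,\mathscr A_b$, and $\operatorname{Sign}(0)=0$. **Theorem.** As $n\to\infty$, $$\mathbb E_{\mathbf A}[\mathcal R(g_n^\lambda)]-\mathcal R^*\to0 ,$$ where $\mathbb E_{\mathbf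 A}$ is the expectation over the random projections with $T_n$ held fixed. The convergence holds in probability with respect to $T_n$, and also after taking the expectation over $T_n$. Consequently RPSTM is consistent, and so is TEC: for all $b\ge1$ and $\gamma\in(-1,1)$, $\mathbb E_{\mathbf A}[\mathbb P(e_{n,b}(\mathscr X)\ne y\mid T_n,\mathscr A_1,\dots,\mathscr A_b)]$ converges, in the same two senses, to the Bayes misclassification probability $\inf_c\mathbb P(c(\mathscr X)\ne y)$, the infimum being over measurable $c$. In both cases the risk is a measurable function of the sample and the projections. -/

import Mathlib

open MeasureTheory ProbabilityTheory Filter Topology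
open scoped ENNReal NNReal

noncomputable section

/-! ### Tensors in CP form and their Gaussian random projections -/

/-- A `d`-mode tensor of size `m 0 × ⋯ × m (d-1)` in rank-`r` CP form
`∑ k, x k 0 ⊗ ⋯ ⊗ x k (d-1)`, given by its factors: `X j k` is the `k`-th factor in mode `j`. -/
abbrev CPTensor (d r : ℕ) (m : Fin d → ℕ) : Type :=
  ∀ j : Fin d, Fin r → EuclideanSpace ℝ (Fin (m j))

/-- One `P j × I j` matrix for every mode `j`. -/
abbrev ProjMatrices (d : ℕ) (I P : Fin d → ℕ) : Type :=
  ∀ j : Fin d, Fin (P j) → Fin (I j) → ℝ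

/-- The law of the projection matrices: all entries are independent standard Gaussians. -/
def gaussianProj (d : ℕ) (I P : Fin d → ℕ) : Measure (ProjMatrices d I P) :=
  Measure.pi fun j => Measure.pi fun _ : Fin (P j) => Measure.pi fun _ : Fin (I j) =>
    gaussianReal 0 1

/-- The projected tensor: the factors in mode `j` are multiplied by the mode-`j` matrix,
scaled by `1 / √(P j)`. -/
def project {d r : ℕ} {I P : Fin d → ℕ} (A : ProjMatrices d I P) (X : CPTensor d r I) :
    CPTensor d r P :=
  fun j k => (√(P j : ℝ))⁻¹ • WithLp.toLp 2 ((Matrix.of (A j)).mulVec (X j k).ofLp)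

/-! ### Kernels -/

/-- The two forms of a vector kernel: `h (‖a - b‖ ^ 2)` and `h ⟪a, b⟫`. -/
inductive KernelForm
  | radial
  | dot

/-- The argument that is fed into `h`. -/
def KernelForm.arg (s : KernelForm) {m : ℕ} (a b : EuclideanSpace ℝ (Fin m)) : ℝ :=
  match s with
  | .radial => ‖a - b‖ ^ 2
  | .dot => inner ℝ a b

/-- The set in which that argument ranges. -/
def KernelForm.domain (s : KernelForm) : Set ℝ :=
  match s with
  | .radial => Set.Ici 0
  | .dot => Set.univ

/-- A vector kernel of one of the two forms, i.e. a function of one of the two forms that is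
positive semidefinite on the Euclidean spaces of all dimensions. -/
structure ModeKernel where
  form : KernelForm
  h : ℝ → ℝ
  posSemidef : ∀ m : ℕ,
    (Matrix.of fun a b : EuclideanSpace ℝ (Fin m) => h (form.arg a b)).PosSemidef

/-- The vector kernel as a function of two vectors of any common dimension. -/
def ModeKernel.eval (κ : ModeKernel) {m : ℕ} (a b : EuclideanSpace ℝ (Fin m)) : ℝ :=
  κ.h (κ.form.arg a b)

/-- The tensor kernel `K(X, Y) = ∑_{k,l} ∏_j K_j(x_k^j, y_l^j)`. -/
def tensorKernel {d r : ℕ} (κ : Fin d → ModeKernel) {m : Fin d → ℕ} (X Y : CPTensor d r m) : ℝ :=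
  ∑ k : Fin r, ∑ l : Fin r, ∏ j : Fin d, (κ j).eval (X j k) (Y j l)

lemma posSemidef_prod_eval {d : ℕ} (κ : Fin d → ModeKernel) (m : Fin d → ℕ) (s : Finset (Fin d)) :
    (Matrix.of fun a b : (∀ j : Fin d, EuclideanSpace ℝ (Fin (m j))) =>
      ∏ j ∈ s, (κ j).eval (a j) (b j)).PosSemidef := by
  classical
  induction s using Finset.induction_on with
  | empty =>
    refine ⟨by ext; simp, fun x => ?_⟩
    have : (x.sum fun i xi => x.sum fun j xj => star xi *
        (Matrix.of fun a b : (∀ j : Fin d, EuclideanSpace ℝ (Fin (m j))) =>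
          ∏ j ∈ (∅ : Finset (Fin d)), (κ j).eval (a j) (b j)) i j * xj)
        = (∑ i ∈ x.support, x i) * (∑ i ∈ x.support, x i) := by
      simp [Finsupp.sum, Finset.sum_mul_sum]
    rw [this]
    exact mul_self_nonneg _
  | insert j s hj ih =>
    have h := (((κ j).posSemidef (m j)).submatrix
      (fun a : (∀ j : Fin d, EuclideanSpace ℝ (Fin (m j))) => a j)).hadamard ih
    have he : (Matrix.of fun a b : (∀ j : Fin d, EuclideanSpace ℝ (Fin (m j))) =>
        ∏ i ∈ insert j s, (κ i).eval (a i) (b i)) =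
        ((Matrix.of fun a b : EuclideanSpace ℝ (Fin (m j)) =>
          (κ j).h ((κ j).form.arg a b)).submatrix
          (fun a : (∀ j : Fin d, EuclideanSpace ℝ (Fin (m j))) => a j) (fun a => a j)).hadamard
          (Matrix.of fun a b => ∏ i ∈ s, (κ i).eval (a i) (b i)) := by
      ext a b
      simp [Finset.prod_insert hj, ModeKernel.eval]
    rw [he]
    exact h

lemma posSemidef_tensorKernel {d r : ℕ} (κ : Fin d → ModeKernel) (m : Fin d → ℕ) :
    (Matrix.of fun X Y : CPTensor d r m => tensorKernel κ X Y).PosSemidef := by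
  have h := posSemidef_prod_eval κ m Finset.univ
  refine ⟨?_, fun x => ?_⟩
  · ext X Y
    have hs : ∀ a b : (∀ j : Fin d, EuclideanSpace ℝ (Fin (m j))),
        ∏ j, (κ j).eval (b j) (a j) = ∏ j, (κ j).eval (a j) (b j) := fun a b => by
      simpa using h.1.apply a b
    simp only [Matrix.conjTranspose_apply, Matrix.of_apply, tensorKernel, star_trivial]
    rw [Finset.sum_comm]
    exact Finset.sum_congr rfl fun k _ => Finset.sum_congr rfl fun l _ =>
      hs (fun j => X j k) (fun j => Y j l)
  · have := h.2 (x.sum fun X c => ∑ k : Fin r, Finsupp.single (fun j => X j k) c)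
    have key : ∀ g : (∀ j : Fin d, EuclideanSpace ℝ (Fin (m j))) → ℝ →+ ℝ,
        ((x.sum fun X c => ∑ k : Fin r, Finsupp.single (fun j => X j k) c).sum fun i c => g i c)
          = x.sum fun X c => ∑ k : Fin r, g (fun j => X j k) c := fun g => by
      rw [Finsupp.sum_sum_index (by simp) (by simp)]
      refine Finsupp.sum_congr fun X _ => ?_
      rw [← Finsupp.sum_finsetSum_index (by simp) (by simp)]
      simp
    have k2 := fun i xi => key fun j => AddMonoidHom.mulLeft (star xi *
      (Matrix.of fun a b : (∀ j : Fin d, EuclideanSpace ℝ (Fin (m j))) =>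
          ∏ j, (κ j).eval (a j) (b j)) i j)
    simp only [AddMonoidHom.coe_mulLeft] at k2
    simp only [k2] at this
    have k3 := key fun i =>
      { toFun := fun xi => x.sum fun Y c => ∑ l : Fin r, star xi *
          (Matrix.of fun a b : (∀ j : Fin d, EuclideanSpace ℝ (Fin (m j))) =>
            ∏ j, (κ j).eval (a j) (b j)) i (fun j => Y j l) * c
        map_zero' := by simp
        map_add' := fun a b => by
          simp [add_mul, Finset.sum_add_distrib, Finsupp.sum_add] }
    simp only [AddMonoidHom.coe_mk, ZeroHom.coe_mk] at k3
    rw [k3] at this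
    refine this.trans_eq ?_
    refine Finsupp.sum_congr fun X _ => ?_
    simp only [Finsupp.sum]
    rw [Finset.sum_comm]
    refine Finset.sum_congr rfl fun Y _ => ?_
    simp only [tensorKernel, Matrix.of_apply, Finset.mul_sum, Finset.sum_mul]

/-- The tensor kernel as an operator-valued kernel: `K(X, Y)` acts on `ℝ` by multiplication. -/
def tensorKernelOp {d : ℕ} (r : ℕ) (κ : Fin d → ModeKernel) (m : Fin d → ℕ) :
    Matrix (CPTensor d r m) (CPTensor d r m) (ℝ →L[ℝ] ℝ) :=
  Matrix.of fun X Y => tensorKernel κ X Y • (1 : ℝ →L[ℝ] ℝ)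

instance fact_posSemidef_tensorKernelOp {d : ℕ} (r : ℕ) (κ : Fin d → ModeKernel)
    (m : Fin d → ℕ) : Fact (tensorKernelOp r κ m).PosSemidef := by
  have h := posSemidef_tensorKernel (r := r) κ m
  have hs : ∀ X Y : CPTensor d r m, tensorKernel κ Y X = tensorKernel κ X Y := fun X Y => by
    simpa using h.1.apply X Y
  have ht := (RKHS.posSemidef_tfae (K := tensorKernelOp r κ m)).out 0 2
  refine ⟨?_⟩
  rw [ht]
  refine ⟨?_, fun v => ?_⟩
  · ext X Y
    simp [tensorKernelOp, Matrix.conjTranspose_apply, hs]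
  · refine (h.2 v).trans_eq ?_
    simp only [tensorKernelOp, Matrix.of_apply, star_trivial, RCLike.re_to_real]
    refine Finsupp.sum_congr fun X _ => Finsupp.sum_congr fun Y _ => ?_
    simp [hs X Y]
    ring

/-- The reproducing kernel Hilbert space of the tensor kernel on CP tensors of size `m`. -/
abbrev TensorRKHS {d : ℕ} (r : ℕ) (κ : Fin d → ModeKernel) (m : Fin d → ℕ) : Type :=
  RKHS.OfKernel (tensorKernelOp r κ m)

/-! ### Losses, risks and regularized empirical risk minimization -/

/-- The hinge loss and the squared hinge loss. -/
inductive MarginLoss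
  | hinge
  | sqHinge

/-- `L(y, t) = max(0, 1 - y t)`, respectively its square. -/
def MarginLoss.eval (L : MarginLoss) (y t : ℝ) : ℝ :=
  match L with
  | .hinge => max 0 (1 - y * t)
  | .sqHinge => max 0 (1 - y * t) ^ 2

/-- The exponent of `λ` against which the projection error is compared. -/
def MarginLoss.exponent (L : MarginLoss) : ℝ :=
  match L with
  | .hinge => 1
  | .sqHinge => 3 / 2

/-- `R(f) = E L(y, f(X))`. -/
def risk {X : Type*} [MeasurableSpace X] (L : MarginLoss) (μ : Measure (X × ℝ)) (f : X → ℝ) :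
    ℝ≥0∞ :=
  ∫⁻ z, ENNReal.ofReal (L.eval z.2 (f z.1)) ∂μ

/-- `R* = inf R(f)` over all measurable `f`. -/
def bayesLossRisk {X : Type*} [MeasurableSpace X] (L : MarginLoss) (μ : Measure (X × ℝ)) : ℝ≥0∞ :=
  ⨅ (f : X → ℝ) (_ : Measurable f), risk L μ f

/-- The approximation error `D(λ) = inf_f (R(f) - R* + λ ‖f‖²)` over a reproducing kernel
Hilbert space `H`. -/
def approxError {X : Type*} [MeasurableSpace X] (H : Type*) [NormedAddCommGroup H]
    [InnerProductSpace ℝ H] [RKHS ℝ H X ℝ] (L : MarginLoss) (μ : Measure (X × ℝ)) (lam : ℝ) :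
    ℝ≥0∞ :=
  ⨅ f : H, (risk L μ f - bayesLossRisk L μ + ENNReal.ofReal (lam * ‖f‖ ^ 2))

/-- The regularized empirical risk `(1/n) ∑ L(y_i, g(x_i)) + λ ‖g‖²`. -/
def regEmpRisk {X H : Type*} [NormedAddCommGroup H] [InnerProductSpace ℝ H] [RKHS ℝ H X ℝ]
    (L : MarginLoss) (lam : ℝ) {n : ℕ} (S : Fin n → X × ℝ) (g : H) : ℝ :=
  (1 / (n : ℝ)) * ∑ i, L.eval (S i).2 (g (S i).1) + lam * ‖g‖ ^ 2

/-- The minimizer of the regularized empirical risk over `H`. -/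
def regERM {X : Type*} (H : Type*) [NormedAddCommGroup H] [InnerProductSpace ℝ H] [RKHS ℝ H X ℝ]
    (L : MarginLoss) (lam : ℝ) {n : ℕ} (S : Fin n → X × ℝ) : H :=
  Classical.epsilon fun g : H => ∀ g' : H, regEmpRisk L lam S g ≤ regEmpRisk L lam S g'

/-- The random projection based support tensor machine, as a function of the unprojected tensor:
the minimizer `g` of the regularized empirical risk of the projected sample, evaluated at the
projection of `X`. -/
def rpstm {d r : ℕ} (κ : Fin d → ModeKernel) (L : MarginLoss) (lam : ℝ) {I P : Fin d → ℕ} {n : ℕ}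
    (S : Fin n → CPTensor d r I × ℝ) (A : ProjMatrices d I P) (X : CPTensor d r I) : ℝ :=
  regERM (TensorRKHS r κ P) L lam (fun i => (project A (S i).1, (S i).2)) (project A X)

/-! ### The ensemble classifier -/

/-- The ensemble classifier: the value is `1` if the average of the signs is at least `γ`,
and `-1` otherwise. -/
def ensemble {X : Type*} (γ : ℝ) {b : ℕ} (g : Fin b → X → ℝ) (x : X) : ℝ :=
  if γ ≤ (1 / (b : ℝ)) * ∑ i, Real.sign (g i x) then 1 else -1

/-- The probability that the classifier `c` predicts a wrong label. -/
def misclassRisk {X : Type*} [MeasurableSpace X] (μ : Measure (X × ℝ)) (c : X → ℝ) : ℝ≥0∞ :=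
  μ {z | c z.1 ≠ z.2}

/-- The smallest misclassification probability of a measurable classifier. -/
def bayesMisclassRisk {X : Type*} [MeasurableSpace X] (μ : Measure (X × ℝ)) : ℝ≥0∞ :=
  ⨅ (c : X → ℝ) (_ : Measurable c), misclassRisk μ c

/-! ### Consistency of a randomized classifier -/

/-- `ρ n s q` is the risk of the classifier that is trained on the sample `s : S n` (of law `P n`)
with the random projections `q : Q n` (of law `G n`). Consistency: the risk is a measurable function
of the sample and the projections, and its expectation over the projections converges to `a`,
both in probability and in mean with respect to the sample. -/
def RiskConsistent {S Q : ℕ → Type*} [∀ n, MeasurableSpace (S n)] [∀ n, MeasurableSpace (Q n)]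
    (P : ∀ n, Measure (S n)) (G : ∀ n, Measure (Q n)) (ρ : ∀ n, S n → Q n → ℝ≥0∞) (a : ℝ≥0∞) :
    Prop :=
  (∀ n, Measurable fun p : S n × Q n => ρ n p.1 p.2) ∧
  (∀ δ : ℝ≥0∞, 0 < δ →
    Tendsto (fun n => P n {s | (∫⁻ q, ρ n s q ∂G n) ∉ Set.Icc (a - δ) (a + δ)}) atTop (𝓝 0)) ∧
  Tendsto (fun n => ∫⁻ s, ∫⁻ q, ρ n s q ∂G n ∂P n) atTop (𝓝 a)

end

/-! ### The margin losses -/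

namespace MarginLoss

lemma eval_nonneg (L : MarginLoss) (y t : ℝ) : 0 ≤ L.eval y t := by
  cases L <;> simp only [eval] <;> positivity

@[fun_prop]
lemma continuous_eval (L : MarginLoss) : Continuous fun p : ℝ × ℝ => L.eval p.1 p.2 := by
  cases L <;> simp only [eval] <;> fun_prop

lemma measurable_eval (L : MarginLoss) {α : Type*} [MeasurableSpace α] {y t : α → ℝ}
    (hy : Measurable y) (ht : Measurable t) : Measurable fun a => L.eval (y a) (t a) :=
  L.continuous_eval.measurable.comp (hy.prodMk ht)

lemma eval_zero (L : MarginLoss) (y : ℝ) : L.eval y 0 = 1 := by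
  cases L <;> simp [eval]

lemma eval_midpoint_le (L : MarginLoss) (y s t : ℝ) :
    L.eval y ((s + t) / 2) ≤ (L.eval y s + L.eval y t) / 2 := by
  have h : max 0 (1 - y * ((s + t) / 2)) ≤ (max 0 (1 - y * s) + max 0 (1 - y * t)) / 2 := by
    rcases max_cases 0 (1 - y * s) with h | h <;> rcases max_cases 0 (1 - y * t) with h' | h' <;>
      rw [max_le_iff] <;> constructor <;> linarith [h.1, h.2, h'.1, h'.2]
  cases L with
  | hinge => exact h
  | sqHinge =>
    simp only [eval]
    have h0 : 0 ≤ max 0 (1 - y * ((s + t) / 2)) := le_max_left _ _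
    nlinarith [sq_nonneg (max 0 (1 - y * s) - max 0 (1 - y * t)), pow_le_pow_left₀ h0 h 2]

lemma abs_eval_sub_eval_le (L : MarginLoss) (y y' t t' : ℝ) :
    |L.eval y t - L.eval y' t'| ≤ (2 + |y * t| + |y' * t'|) * |y * t - y' * t'| := by
  have h : |max 0 (1 - y * t) - max 0 (1 - y' * t')| ≤ |y * t - y' * t'| := by
    refine (abs_max_sub_max_le_max _ _ _ _).trans ?_
    rw [sub_self, abs_zero, max_eq_right (abs_nonneg _), abs_sub_comm]
    exact le_of_eq (by congr 1; ring)
  have hb : ∀ s : ℝ, max 0 (1 - s) ≤ 1 + |s| := fun s =>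
    max_le (by positivity) (by linarith [neg_abs_le s])
  cases L with
  | hinge =>
    simp only [eval]
    refine h.trans (le_mul_of_one_le_left (abs_nonneg _) ?_)
    linarith [abs_nonneg (y * t), abs_nonneg (y' * t')]
  | sqHinge =>
    simp only [eval]
    rw [sq_sub_sq, abs_mul]
    refine mul_le_mul ?_ h (abs_nonneg _) (by positivity)
    rw [abs_of_nonneg (by positivity)]
    linarith [hb (y * t), hb (y' * t')]

lemma abs_eval_sub_le (L : MarginLoss) {y t t' M : ℝ} (hy : |y| = 1) (ht : |t| ≤ M)
    (ht' : |t'| ≤ M) : |L.eval y t - L.eval y t'| ≤ 2 * (1 + M) * |t - t'| := by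
  refine (L.abs_eval_sub_eval_le y y t t').trans ?_
  rw [← mul_sub, abs_mul, abs_mul, abs_mul, hy]
  have h0 : 0 ≤ M := (abs_nonneg t).trans ht
  exact mul_le_mul (by linarith) (one_mul _).le (by positivity) (by positivity)

end MarginLoss

/-! ### Minimizers of strongly midpoint convex functions -/

lemma mul_norm_sub_sq_le_of_isMin {H : Type*} [NormedAddCommGroup H] [InnerProductSpace ℝ H]
    {F : H → ℝ} {c : ℝ}
    (hmid : ∀ a b, F ((1 / 2 : ℝ) • (a + b)) ≤ (F a + F b) / 2 - c * ‖a - b‖ ^ 2) {w : H}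
    (hw : ∀ g, F w ≤ F g) (g : H) : 2 * c * ‖g - w‖ ^ 2 ≤ F g - F w := by
  linarith [hmid g w, hw ((1 / 2 : ℝ) • (g + w))]

lemma exists_isMin_of_midpoint_le {H : Type*} [NormedAddCommGroup H] [InnerProductSpace ℝ H]
    [CompleteSpace H] {F : H → ℝ} {c : ℝ} (hc : 0 < c) (hF : Continuous F) (hF0 : ∀ a, 0 ≤ F a)
    (hmid : ∀ a b, F ((1 / 2 : ℝ) • (a + b)) ≤ (F a + F b) / 2 - c * ‖a - b‖ ^ 2) :
    ∃ w, ∀ g, F w ≤ F g := by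
  set m := ⨅ a, F a with hm
  have hbdd : BddBelow (Set.range F) := ⟨0, by rintro _ ⟨a, rfl⟩; exact hF0 a⟩
  have hle : ∀ a, m ≤ F a := fun a => ciInf_le hbdd a
  have hex : ∀ n : ℕ, ∃ a, F a < m + 1 / ((n : ℝ) + 1) := fun n =>
    exists_lt_of_ciInf_lt (lt_add_of_pos_right _ Nat.one_div_pos_of_nat)
  choose w hw using hex
  have hdist : ∀ n k N : ℕ, N ≤ n → N ≤ k →
      dist (w n) (w k) ≤ √(1 / ((N : ℝ) + 1) / c) := fun n k N hn hk => by
    rw [dist_eq_norm]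
    refine Real.le_sqrt_of_sq_le ?_
    rw [le_div_iff₀ hc]
    have h1 : 1 / ((n : ℝ) + 1) ≤ 1 / ((N : ℝ) + 1) := Nat.one_div_le_one_div hn
    have h2 : 1 / ((k : ℝ) + 1) ≤ 1 / ((N : ℝ) + 1) := Nat.one_div_le_one_div hk
    linarith [hmid (w n) (w k), hle ((1 / 2 : ℝ) • (w n + w k)), hw n, hw k]
  have hz : Tendsto (fun N : ℕ => √(1 / ((N : ℝ) + 1) / c)) atTop (𝓝 0) := by
    have := (tendsto_one_div_add_atTop_nhds_zero_nat (𝕜 := ℝ)).div_const c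
    simpa using this.sqrt
  obtain ⟨v, hv⟩ := cauchySeq_tendsto_of_complete (cauchySeq_of_le_tendsto_0 _ hdist hz)
  refine ⟨v, fun g => le_trans ?_ (hle g)⟩
  have h1 : Tendsto (fun n : ℕ => m + 1 / ((n : ℝ) + 1)) atTop (𝓝 (m + 0)) :=
    tendsto_const_nhds.add tendsto_one_div_add_atTop_nhds_zero_nat
  rw [add_zero] at h1
  exact le_of_tendsto_of_tendsto' ((hF.tendsto v).comp hv) h1 fun n => (hw n).le

/-! ### Regularized empirical risk minimization -/

section RegERM

variable {X H : Type*} [NormedAddCommGroup H] [InnerProductSpace ℝ H] [RKHS ℝ H X ℝ]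

lemma regEmpRisk_midpoint_le (L : MarginLoss) (lam : ℝ) {n : ℕ} (S : Fin n → X × ℝ) (a b : H) :
    regEmpRisk L lam S ((1 / 2 : ℝ) • (a + b)) ≤
      (regEmpRisk L lam S a + regEmpRisk L lam S b) / 2 - lam / 4 * ‖a - b‖ ^ 2 := by
  have h1 : ∑ i, L.eval (S i).2 (((1 / 2 : ℝ) • (a + b)) (S i).1) ≤
      (∑ i, L.eval (S i).2 (a (S i).1) + ∑ i, L.eval (S i).2 (b (S i).1)) / 2 := by
    rw [← Finset.sum_add_distrib, Finset.sum_div]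
    refine Finset.sum_le_sum fun i _ => ?_
    have h : ((1 / 2 : ℝ) • (a + b)) (S i).1 = (a (S i).1 + b (S i).1) / 2 := by
      rw [RKHS.coe_smul, RKHS.coe_add, Pi.smul_apply, Pi.add_apply, smul_eq_mul]
      ring
    rw [h]
    exact L.eval_midpoint_le _ _ _
  have h2 : ‖(1 / 2 : ℝ) • (a + b)‖ ^ 2 = (‖a‖ ^ 2 + ‖b‖ ^ 2) / 2 - ‖a - b‖ ^ 2 / 4 := by
    rw [norm_smul, mul_pow, @norm_add_sq_real, @norm_sub_sq_real]
    norm_num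
    ring
  have h3 : (0 : ℝ) ≤ 1 / n := by positivity
  simp only [regEmpRisk, h2]
  linarith [mul_le_mul_of_nonneg_left h1 h3]

lemma regEmpRisk_nonneg (L : MarginLoss) {lam : ℝ} (hlam : 0 < lam) {n : ℕ} (S : Fin n → X × ℝ)
    (g : H) : 0 ≤ regEmpRisk L lam S g := by
  have := Finset.sum_nonneg fun i (_ : i ∈ Finset.univ) => L.eval_nonneg (S i).2 (g (S i).1)
  unfold regEmpRisk
  positivity

lemma continuous_regEmpRisk (L : MarginLoss) (lam : ℝ) {n : ℕ} (S : Fin n → X × ℝ) :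
    Continuous fun g : H => regEmpRisk L lam S g := by
  unfold regEmpRisk
  refine (continuous_const.mul (continuous_finsetSum _ fun i _ => ?_)).add (by fun_prop)
  exact L.continuous_eval.comp (continuous_const.prodMk (RKHS.continuous_eval (S i).1))

variable (H) [CompleteSpace H]

lemma regEmpRisk_regERM_le (L : MarginLoss) {lam : ℝ} (hlam : 0 < lam) {n : ℕ}
    (S : Fin n → X × ℝ) (g : H) : regEmpRisk L lam S (regERM H L lam S) ≤ regEmpRisk L lam S g :=
  Classical.epsilon_spec (exists_isMin_of_midpoint_le (c := lam / 4) (by linarith)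
    (continuous_regEmpRisk L lam S) (regEmpRisk_nonneg L hlam S)
    (regEmpRisk_midpoint_le L lam S)) g

lemma mul_norm_sub_regERM_sq_le (L : MarginLoss) {lam : ℝ} (hlam : 0 < lam) {n : ℕ}
    (S : Fin n → X × ℝ) (g : H) :
    lam / 2 * ‖g - regERM H L lam S‖ ^ 2 ≤
      regEmpRisk L lam S g - regEmpRisk L lam S (regERM H L lam S) := by
  have := mul_norm_sub_sq_le_of_isMin (regEmpRisk_midpoint_le L lam S)
    (regEmpRisk_regERM_le H L hlam S) g
  linarith

lemma norm_regERM_sq_le (L : MarginLoss) {lam : ℝ} (hlam : 0 < lam) {n : ℕ}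
    (S : Fin n → X × ℝ) : ‖regERM H L lam S‖ ^ 2 ≤ 1 / lam := by
  have h := regEmpRisk_regERM_le H L hlam S 0
  have h0 := Finset.sum_nonneg fun i (_ : i ∈ Finset.univ) =>
    L.eval_nonneg (S i).2 (regERM H L lam S (S i).1)
  have h1 : (1 / n : ℝ) * n ≤ 1 := by
    rw [one_div_mul_eq_div]
    exact div_self_le_one _
  have h2 : (0 : ℝ) ≤ (1 / n : ℝ) * ∑ i, L.eval (S i).2 (regERM H L lam S (S i).1) := by positivity
  simp only [regEmpRisk, RKHS.coe_zero, Pi.zero_apply, MarginLoss.eval_zero, Finset.sum_const,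
    Finset.card_univ, Fintype.card_fin, nsmul_eq_mul, mul_one, norm_zero] at h
  rw [le_div_iff₀ hlam]
  linarith

lemma norm_regERM_le (L : MarginLoss) {lam : ℝ} (hlam : 0 < lam) {n : ℕ}
    (S : Fin n → X × ℝ) : ‖regERM H L lam S‖ ≤ √(1 / lam) :=
  Real.le_sqrt_of_sq_le (norm_regERM_sq_le H L hlam S)

variable {H}

lemma apply_eq_inner_kerFun (g : H) (x : X) : g x = inner ℝ (RKHS.kerFun H x (1 : ℝ)) g := by
  simp

lemma mul_apply_eq_inner (g : H) (z : X × ℝ) :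
    z.2 * g z.1 = inner ℝ (z.2 • RKHS.kerFun H z.1 (1 : ℝ)) g := by
  rw [real_inner_smul_left, ← apply_eq_inner_kerFun]

lemma abs_apply_le_of_norm_kerFun_le {B : ℝ} (hB : ∀ x, ‖RKHS.kerFun H x (1 : ℝ)‖ ≤ B) (g : H)
    (x : X) : |g x| ≤ B * ‖g‖ := by
  rw [apply_eq_inner_kerFun]
  exact (abs_real_inner_le_norm _ _).trans (mul_le_mul_of_nonneg_right (hB x) (norm_nonneg _))

lemma abs_regEmpRisk_sub_le (L : MarginLoss) (lam : ℝ) {n : ℕ} (S S' : Fin n → X × ℝ) {g : H}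
    {B : ℝ} (hg : ‖g‖ ≤ B) :
    |regEmpRisk L lam S g - regEmpRisk L lam S' g| ≤
      (1 / (n : ℝ)) * ∑ i, (2 + ‖(S i).2 • RKHS.kerFun H (S i).1 (1 : ℝ)‖ * B +
        ‖(S' i).2 • RKHS.kerFun H (S' i).1 (1 : ℝ)‖ * B) *
        (‖(S i).2 • RKHS.kerFun H (S i).1 (1 : ℝ) -
          (S' i).2 • RKHS.kerFun H (S' i).1 (1 : ℝ)‖ * B) := by
  have hin : ∀ v : H, |inner ℝ v g| ≤ ‖v‖ * B := fun v =>
    (abs_real_inner_le_norm _ _).trans (mul_le_mul_of_nonneg_left hg (norm_nonneg _))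
  simp only [regEmpRisk, add_sub_add_right_eq_sub]
  rw [← mul_sub, abs_mul, abs_of_nonneg (by positivity : (0 : ℝ) ≤ 1 / n), ← Finset.sum_sub_distrib]
  refine mul_le_mul_of_nonneg_left ?_ (by positivity)
  refine (Finset.abs_sum_le_sum_abs _ _).trans (Finset.sum_le_sum fun i _ => ?_)
  refine (L.abs_eval_sub_eval_le _ _ _ _).trans ?_
  have hB : 0 ≤ B := (norm_nonneg g).trans hg
  rw [mul_apply_eq_inner, mul_apply_eq_inner, ← inner_sub_left]
  gcongr <;> exact hin _

lemma continuous_regERM [TopologicalSpace X]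
    (hΦ : Continuous fun x : X => RKHS.kerFun H x (1 : ℝ)) (L : MarginLoss) {lam : ℝ}
    (hlam : 0 < lam) (n : ℕ) : Continuous fun S : Fin n → X × ℝ => regERM H L lam S := by
  refine continuous_iff_continuousAt.2 fun S₀ => ?_
  set B := √(1 / lam)
  set g₀ := regERM H L lam S₀
  let E : (Fin n → X × ℝ) → ℝ := fun S =>
    (1 / (n : ℝ)) * ∑ i, (2 + ‖(S₀ i).2 • RKHS.kerFun H (S₀ i).1 (1 : ℝ)‖ * B +
        ‖(S i).2 • RKHS.kerFun H (S i).1 (1 : ℝ)‖ * B) *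
        (‖(S₀ i).2 • RKHS.kerFun H (S₀ i).1 (1 : ℝ) -
          (S i).2 • RKHS.kerFun H (S i).1 (1 : ℝ)‖ * B)
  have hE : Continuous E := by
    have : ∀ i, Continuous fun S : Fin n → X × ℝ => RKHS.kerFun H (S i).1 (1 : ℝ) := fun i =>
      hΦ.comp (by fun_prop)
    fun_prop
  have hE0 : E S₀ = 0 := by simp [E]
  have key : ∀ S, ‖regERM H L lam S - g₀‖ ^ 2 ≤ 2 * E S / lam := fun S => by
    rw [le_div_iff₀ hlam]
    have h1 := mul_norm_sub_regERM_sq_le H L hlam S₀ (regERM H L lam S)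
    have h2 := mul_norm_sub_regERM_sq_le H L hlam S g₀
    have h3 := abs_le.1 (abs_regEmpRisk_sub_le L lam S₀ S (norm_regERM_le H L hlam S))
    have h4 := abs_le.1 (abs_regEmpRisk_sub_le L lam S₀ S (norm_regERM_le H L hlam S₀))
    rw [norm_sub_rev] at h2
    change _ ∧ _ ≤ E S at h3
    change -E S ≤ _ ∧ _ at h4
    linarith [h3.2, h4.1]
  have hlim : Tendsto (fun S => 2 * E S / lam) (𝓝 S₀) (𝓝 0) := by
    have := ((hE.tendsto S₀).const_mul 2).div_const lam
    rwa [hE0, mul_zero, zero_div] at this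
  have hsq := squeeze_zero (fun S => sq_nonneg ‖regERM H L lam S - g₀‖) key hlim
  refine tendsto_iff_norm_sub_tendsto_zero.2 ?_
  simpa using hsq.sqrt

lemma continuous_regERM_apply [TopologicalSpace X]
    (hΦ : Continuous fun x : X => RKHS.kerFun H x (1 : ℝ)) (L : MarginLoss) {lam : ℝ}
    (hlam : 0 < lam) (n : ℕ) :
    Continuous fun p : (Fin n → X × ℝ) × X => regERM H L lam p.1 p.2 := by
  simp only [apply_eq_inner_kerFun]
  exact (hΦ.comp continuous_snd).inner ((continuous_regERM hΦ L hlam n).comp continuous_fst)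

end RegERM

/-! ### The oracle inequality for regularized empirical risk minimization -/

/-- A bound for the change of the loss at a point when this point is added to the sample. -/
noncomputable def stabilityBound (B lam : ℝ) (n : ℕ) : ℝ :=
  (2 * (1 + B * √(2 / lam)) * B) ^ 2 / (n * lam)

lemma stabilityBound_nonneg {B lam : ℝ} (hlam : 0 < lam) (n : ℕ) : 0 ≤ stabilityBound B lam n := by
  unfold stabilityBound
  positivity

lemma stabilityBound_le {B lam : ℝ} (hlam : 0 < lam) (hlam1 : lam ≤ 1) (n : ℕ) :
    stabilityBound B lam n ≤ 8 * (1 + 2 * B ^ 2) * B ^ 2 * (n * lam ^ 2)⁻¹ := by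
  rcases Nat.eq_zero_or_pos n with rfl | hn
  · simp [stabilityBound]
  have hn' : (0 : ℝ) < n := Nat.cast_pos.2 hn
  have hs : √(2 / lam) ^ 2 = 2 / lam := Real.sq_sqrt (by positivity)
  have h1 : (1 + B * √(2 / lam)) ^ 2 ≤ 2 * (1 + 2 * B ^ 2) / lam := by
    have h2 : (1 + B * √(2 / lam)) ^ 2 ≤ 2 * (1 + B ^ 2 * (2 / lam)) := by
      have h3 : B ^ 2 * (2 / lam) = (B * √(2 / lam)) ^ 2 := by rw [mul_pow, hs]
      rw [h3]
      nlinarith [sq_nonneg (1 - B * √(2 / lam))]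
    refine h2.trans ?_
    rw [le_div_iff₀ hlam]
    have : 2 * (1 + B ^ 2 * (2 / lam)) * lam = 2 * (lam + 2 * B ^ 2) := by
      field_simp
    rw [this]
    linarith
  calc stabilityBound B lam n = 4 * B ^ 2 / (n * lam) * (1 + B * √(2 / lam)) ^ 2 := by
        unfold stabilityBound; ring
    _ ≤ 4 * B ^ 2 / (n * lam) * (2 * (1 + 2 * B ^ 2) / lam) := by gcongr
    _ = _ := by field_simp; ring

section Oracle

variable {X H : Type*} [NormedAddCommGroup H] [InnerProductSpace ℝ H] [RKHS ℝ H X ℝ]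
  [CompleteSpace H]

lemma eval_regERM_removeNth_le (L : MarginLoss) {lam : ℝ} (hlam : 0 < lam) {n : ℕ} (hn : 0 < n)
    {B : ℝ} (hB0 : 0 ≤ B) (hB : ∀ x, ‖RKHS.kerFun H x (1 : ℝ)‖ ≤ B) (z : Fin (n + 1) → X × ℝ)
    (hz : ∀ i, |(z i).2| = 1) (i : Fin (n + 1)) :
    L.eval (z i).2 (regERM H L lam (i.removeNth z) (z i).1) ≤
      L.eval (z i).2 (regERM H L (n * lam / (n + 1)) z (z i).1) + stabilityBound B lam n := by
  have hn' : (0 : ℝ) < n := Nat.cast_pos.2 hn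
  have hn1 : (1 : ℝ) ≤ n := Nat.one_le_cast.2 hn
  set lam' : ℝ := n * lam / (n + 1) with hlam'
  have hlam'0 : 0 < lam' := by positivity
  set w := regERM H L lam (i.removeNth z)
  set W := regERM H L lam' z
  have hscale : ∀ g : H, (n + 1 : ℝ) * regEmpRisk L lam' z g =
      L.eval (z i).2 (g (z i).1) + n * regEmpRisk L lam (i.removeNth z) g := fun g => by
    simp only [regEmpRisk, Fin.sum_univ_succAbove _ i, Fin.removeNth_apply, hlam']
    push_cast
    field_simp
    ring
  have h1 := mul_norm_sub_regERM_sq_le H L hlam'0 z w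
  have h2 := mul_norm_sub_regERM_sq_le H L hlam (i.removeNth z) W
  have h1' := mul_le_mul_of_nonneg_left h1 (by positivity : (0 : ℝ) ≤ n + 1)
  have h2' := mul_le_mul_of_nonneg_left h2 hn'.le
  rw [mul_sub, hscale, hscale] at h1'
  rw [norm_sub_rev] at h2'
  have h3 : (n + 1 : ℝ) * (lam' / 2 * ‖w - W‖ ^ 2) = n * lam / 2 * ‖w - W‖ ^ 2 := by
    rw [hlam']; field_simp
  rw [h3] at h1'
  have h4 : n * lam * ‖w - W‖ ^ 2 ≤ L.eval (z i).2 (w (z i).1) - L.eval (z i).2 (W (z i).1) := by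
    linarith
  have hs1 : √(1 / lam) ≤ √(2 / lam) := Real.sqrt_le_sqrt (by gcongr; norm_num)
  have hs2 : √(1 / lam') ≤ √(2 / lam) := Real.sqrt_le_sqrt (by
    rw [hlam', div_le_div_iff₀ (by positivity) hlam, mul_div_assoc', le_div_iff₀ (by positivity)]
    nlinarith)
  have hw : |w (z i).1| ≤ B * √(2 / lam) := (abs_apply_le_of_norm_kerFun_le hB w _).trans
    (mul_le_mul_of_nonneg_left ((norm_regERM_le H L hlam _).trans hs1) hB0)
  have hW : |W (z i).1| ≤ B * √(2 / lam) := (abs_apply_le_of_norm_kerFun_le hB W _).trans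
    (mul_le_mul_of_nonneg_left ((norm_regERM_le H L hlam'0 _).trans hs2) hB0)
  have hD : |w (z i).1 - W (z i).1| ≤ B * ‖w - W‖ := by
    have := abs_apply_le_of_norm_kerFun_le hB (w - W) (z i).1
    rwa [RKHS.coe_sub, Pi.sub_apply] at this
  set a := 2 * (1 + B * √(2 / lam)) * B with ha
  have ha0 : 0 ≤ a := by positivity
  have h5 : L.eval (z i).2 (w (z i).1) - L.eval (z i).2 (W (z i).1) ≤ a * ‖w - W‖ := by
    refine (le_abs_self _).trans ((L.abs_eval_sub_le (hz i) hw hW).trans ?_)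
    rw [ha, mul_assoc _ B]
    exact mul_le_mul_of_nonneg_left hD (by positivity)
  have h6 : n * lam * ‖w - W‖ ≤ a := by
    rcases (norm_nonneg (w - W)).eq_or_lt with h0 | h0
    · rwa [← h0, mul_zero]
    · refine le_of_mul_le_mul_right ?_ h0
      linarith [h4.trans h5, sq ‖w - W‖, mul_assoc (n * lam) ‖w - W‖ ‖w - W‖]
  have h7 : a * ‖w - W‖ ≤ stabilityBound B lam n := by
    rw [stabilityBound, ← ha, le_div_iff₀ (by positivity)]
    nlinarith [mul_le_mul_of_nonneg_left h6 ha0]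
  linarith

lemma sum_eval_regERM_removeNth_le (L : MarginLoss) {lam : ℝ} (hlam : 0 < lam) {n : ℕ} (hn : 0 < n)
    {B : ℝ} (hB0 : 0 ≤ B) (hB : ∀ x, ‖RKHS.kerFun H x (1 : ℝ)‖ ≤ B) (z : Fin (n + 1) → X × ℝ)
    (hz : ∀ i, |(z i).2| = 1) (g : H) :
    ∑ i, L.eval (z i).2 (regERM H L lam (i.removeNth z) (z i).1) ≤
      ∑ i, L.eval (z i).2 (g (z i).1) + (n + 1) * (lam * ‖g‖ ^ 2 + stabilityBound B lam n) := by
  have hn' : (0 : ℝ) < n := Nat.cast_pos.2 hn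
  set lam' : ℝ := n * lam / (n + 1) with hlam'
  have hlam'0 : 0 < lam' := by positivity
  have h1 := Finset.sum_le_sum fun i (_ : i ∈ Finset.univ) =>
    eval_regERM_removeNth_le (H := H) L hlam hn hB0 hB z hz i
  rw [Finset.sum_add_distrib, ← hlam'] at h1
  have h2 := mul_le_mul_of_nonneg_left (regEmpRisk_regERM_le H L hlam'0 z g)
    (by positivity : (0 : ℝ) ≤ n + 1)
  have hscale : ∀ g : H, (n + 1 : ℝ) * regEmpRisk L lam' z g =
      ∑ i, L.eval (z i).2 (g (z i).1) + n * lam * ‖g‖ ^ 2 := fun g => by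
    simp only [regEmpRisk, hlam']
    push_cast
    field_simp
  rw [hscale, hscale] at h2
  simp only [Finset.sum_const, Finset.card_univ, Fintype.card_fin, nsmul_eq_mul] at h1
  push_cast at h1
  have h3 : 0 ≤ n * lam * ‖regERM H L lam' z‖ ^ 2 := by positivity
  have h4 : 0 ≤ lam * ‖g‖ ^ 2 := by positivity
  linarith

lemma lintegral_risk_regERM_le {Z : Type*} [MeasurableSpace Z] (μ : Measure (Z × ℝ))
    [IsProbabilityMeasure μ] (hlabel : ∀ᵐ z ∂μ, |z.2| = 1) (T : Z → X) (L : MarginLoss) {lam : ℝ}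
    (hlam : 0 < lam) {n : ℕ} (hn : 0 < n) {B : ℝ} (hB0 : 0 ≤ B)
    (hB : ∀ x, ‖RKHS.kerFun H x (1 : ℝ)‖ ≤ B)
    (hmeas : Measurable fun p : (Fin n → Z × ℝ) × Z =>
      regERM H L lam (fun i => (T (p.1 i).1, (p.1 i).2)) (T p.2))
    (g : H) (hg : Measurable fun x => g (T x)) :
    ∫⁻ S, risk L μ (fun x => regERM H L lam (fun i => (T (S i).1, (S i).2)) (T x))
        ∂(Measure.pi fun _ : Fin n => μ) ≤
      risk L μ (fun x => g (T x)) + ENNReal.ofReal (lam * ‖g‖ ^ 2 + stabilityBound B lam n) := by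
  let f : (Z × ℝ) × (Fin n → Z × ℝ) → ℝ≥0∞ := fun p => ENNReal.ofReal (L.eval p.1.2
    (regERM H L lam (fun i => (T (p.2 i).1, (p.2 i).2)) (T p.1.1)))
  have hF : Measurable fun p : (Z × ℝ) × (Fin n → Z × ℝ) =>
      regERM H L lam (fun i => (T (p.2 i).1, (p.2 i).2)) (T p.1.1) :=
    Measurable.comp (f := fun p : (Z × ℝ) × (Fin n → Z × ℝ) => (p.2, p.1.1)) hmeas (by fun_prop)
  have hf : Measurable f :=
    (L.measurable_eval (measurable_snd.comp measurable_fst) hF).ennreal_ofReal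
  have hmp : ∀ i : Fin (n + 1), ∫⁻ S, risk L μ
      (fun x => regERM H L lam (fun i => (T (S i).1, (S i).2)) (T x))
        ∂(Measure.pi fun _ : Fin n => μ) =
      ∫⁻ z, f (z i, i.removeNth z) ∂(Measure.pi fun _ : Fin (n + 1) => μ) := fun i => by
    calc _ = ∫⁻ p, f p ∂(μ.prod (Measure.pi fun _ : Fin n => μ)) :=
          (lintegral_prod_symm' f hf).symm
      _ = _ := ((measurePreserving_piFinSuccAbove (fun _ : Fin (n + 1) => μ) i).lintegral_comp
          hf).symm
  have hfi : ∀ i : Fin (n + 1), Measurable fun z : Fin (n + 1) → Z × ℝ => f (z i, i.removeNth z) :=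
    fun i => hf.comp (MeasurableEquiv.piFinSuccAbove (fun _ : Fin (n + 1) => Z × ℝ) i).measurable
  have hgi : ∀ i : Fin (n + 1), Measurable fun z : Fin (n + 1) → Z × ℝ =>
      ENNReal.ofReal (L.eval (z i).2 (g (T (z i).1))) := fun i =>
    (L.measurable_eval (measurable_pi_apply i).snd
      (hg.comp (measurable_pi_apply i).fst)).ennreal_ofReal
  have hgint : ∀ i : Fin (n + 1), ∫⁻ z, ENNReal.ofReal (L.eval (z i).2 (g (T (z i).1)))
      ∂(Measure.pi fun _ : Fin (n + 1) => μ) = risk L μ (fun x => g (T x)) := fun i =>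
    (measurePreserving_eval (fun _ : Fin (n + 1) => μ) i).lintegral_comp
      (f := fun z => ENNReal.ofReal (L.eval z.2 (g (T z.1))))
      (L.measurable_eval measurable_snd (hg.comp measurable_fst)).ennreal_ofReal
  have hae : ∀ᵐ z ∂(Measure.pi fun _ : Fin (n + 1) => μ), ∀ i, |(z i).2| = 1 :=
    ae_all_iff.2 fun i =>
      (measurePreserving_eval (fun _ : Fin (n + 1) => μ) i).quasiMeasurePreserving.ae hlabel
  have hβ := stabilityBound_nonneg (B := B) hlam n
  have hmain : ∫⁻ z, ∑ i, f (z i, i.removeNth z) ∂(Measure.pi fun _ : Fin (n + 1) => μ) ≤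
      ∫⁻ z, (∑ i, ENNReal.ofReal (L.eval (z i).2 (g (T (z i).1))) +
        (n + 1) * ENNReal.ofReal (lam * ‖g‖ ^ 2 + stabilityBound B lam n))
        ∂(Measure.pi fun _ : Fin (n + 1) => μ) := by
    refine lintegral_mono_ae (hae.mono fun z hz => ?_)
    have := sum_eval_regERM_removeNth_le (H := H) L hlam hn hB0 hB
      (fun i => (T (z i).1, (z i).2)) hz g
    have h0 : ∀ i, 0 ≤ L.eval (z i).2 (g (T (z i).1)) := fun i => L.eval_nonneg _ _
    have hcast : ((n : ℝ≥0∞) + 1) = ENNReal.ofReal (n + 1) := by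
      rw [ENNReal.ofReal_add (by positivity) (by positivity)]; simp
    rw [hcast, ← ENNReal.ofReal_mul (by positivity),
      ← ENNReal.ofReal_sum_of_nonneg fun i _ => h0 i,
      ← ENNReal.ofReal_add (Finset.sum_nonneg fun i _ => h0 i) (by positivity),
      ← ENNReal.ofReal_sum_of_nonneg fun i _ => L.eval_nonneg _ _]
    exact ENNReal.ofReal_le_ofReal this
  rw [lintegral_finsetSum _ fun i _ => hfi i, lintegral_add_right _ measurable_const,
    lintegral_finsetSum _ fun i _ => hgi i] at hmain
  simp only [hgint, ← hmp, Finset.sum_const, Finset.card_univ, Fintype.card_fin, nsmul_eq_mul,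
    lintegral_const, measure_univ, mul_one, Nat.cast_add, Nat.cast_one] at hmain
  rw [← mul_add] at hmain
  exact (ENNReal.mul_le_mul_iff_right (by simp) (by finiteness)).1 hmain

end Oracle

/-! ### The tensor kernel and its reproducing kernel Hilbert space -/

lemma KernelForm.arg_mem_domain (s : KernelForm) {m : ℕ} (a b : EuclideanSpace ℝ (Fin m)) :
    s.arg a b ∈ s.domain := by
  cases s <;> simp [arg, domain]

@[fun_prop]
lemma KernelForm.continuous_arg (s : KernelForm) (m : ℕ) :
    Continuous fun p : EuclideanSpace ℝ (Fin m) × EuclideanSpace ℝ (Fin m) => s.arg p.1 p.2 := by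
  cases s <;> simp only [arg] <;> fun_prop

lemma KernelForm.exists_continuous_eqOn (s : KernelForm) {h : ℝ → ℝ} (hh : ContinuousOn h s.domain) :
    ∃ h' : ℝ → ℝ, Continuous h' ∧ Set.EqOn h' h s.domain := by
  cases s with
  | radial =>
    refine ⟨fun t => h (max t 0), hh.comp_continuous (by fun_prop)
      fun t => show (0 : ℝ) ≤ max t 0 from le_max_right _ _,
      fun t ht => ?_⟩
    simp only [max_eq_left (show (0 : ℝ) ≤ t from ht)]
  | dot => exact ⟨h, continuousOn_univ.1 hh, fun _ _ => rfl⟩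

lemma continuous_kerFun_of_continuous_inner {X H : Type*} [NormedAddCommGroup H]
    [InnerProductSpace ℝ H] [RKHS ℝ H X ℝ] [CompleteSpace H] [TopologicalSpace X] {k : X → X → ℝ}
    (hk : ∀ x y, inner ℝ (RKHS.kerFun H x (1 : ℝ)) (RKHS.kerFun H y (1 : ℝ)) = k x y)
    (hc : Continuous fun p : X × X => k p.1 p.2) :
    Continuous fun x => RKHS.kerFun H x (1 : ℝ) := by
  refine continuous_iff_continuousAt.2 fun x₀ => tendsto_iff_norm_sub_tendsto_zero.2 ?_
  have hsq : ∀ x, ‖RKHS.kerFun H x (1 : ℝ) - RKHS.kerFun H x₀ (1 : ℝ)‖ ^ 2 =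
      k x x - 2 * k x x₀ + k x₀ x₀ := fun x => by
    rw [norm_sub_sq_real, hk, ← real_inner_self_eq_norm_sq, ← real_inner_self_eq_norm_sq, hk, hk]
  have hs : Continuous fun x => √(k x x - 2 * k x x₀ + k x₀ x₀) := by
    have h1 : Continuous fun x => k x x := hc.comp (continuous_id.prodMk continuous_id)
    have h2 : Continuous fun x => k x x₀ := hc.comp (continuous_id.prodMk continuous_const)
    fun_prop
  have := hs.tendsto x₀
  simp only [← hsq, Real.sqrt_sq (norm_nonneg _), sub_self, norm_zero,
    zero_pow two_ne_zero, Real.sqrt_zero] at this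
  exact this

section TensorKernel

variable {d r : ℕ} {κ : Fin d → ModeKernel}

lemma exists_continuous_tensorKernel_eq
    (hκ : ∀ j, ContinuousOn (κ j).h (κ j).form.domain) :
    ∃ G : (Fin d → Fin r → Fin r → ℝ) → ℝ, Continuous G ∧ ∀ (m : Fin d → ℕ) (X Y : CPTensor d r m),
      tensorKernel κ X Y = G fun j k l => (κ j).form.arg (X j k) (Y j l) := by
  choose h' hc he using fun j => (κ j).form.exists_continuous_eqOn (hκ j)
  refine ⟨fun t => ∑ k, ∑ l, ∏ j, h' j (t j k l), ?_, fun m X Y => ?_⟩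
  · refine continuous_finsetSum _ fun k _ => continuous_finsetSum _ fun l _ =>
      continuous_finsetProd _ fun j _ => (hc j).comp ?_
    fun_prop
  · simp only [tensorKernel, ModeKernel.eval]
    refine Finset.sum_congr rfl fun k _ => Finset.sum_congr rfl fun l _ =>
      Finset.prod_congr rfl fun j _ => (he j ((κ j).form.arg_mem_domain _ _)).symm

lemma continuous_tensorKernel (hκ : ∀ j, ContinuousOn (κ j).h (κ j).form.domain)
    (m : Fin d → ℕ) :
    Continuous fun p : CPTensor d r m × CPTensor d r m => tensorKernel κ p.1 p.2 := by
  obtain ⟨G, hG, hG'⟩ := exists_continuous_tensorKernel_eq (r := r) hκ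
  simp only [hG']
  refine hG.comp (continuous_pi fun j => continuous_pi fun k => continuous_pi fun l => ?_)
  exact ((κ j).form.continuous_arg (m j)).comp
    (f := fun p : CPTensor d r m × CPTensor d r m => (p.1 j k, p.2 j l)) (by fun_prop)

/-- The feature map of the tensor kernel. -/
noncomputable abbrev tensorFeature (κ : Fin d → ModeKernel) {m : Fin d → ℕ} (X : CPTensor d r m) :
    TensorRKHS r κ m :=
  RKHS.kerFun (TensorRKHS r κ m) X (1 : ℝ)

lemma tensorFeature_apply {m : Fin d → ℕ} (X Y : CPTensor d r m) :
    tensorFeature κ Y X = tensorKernel κ X Y := by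
  rw [tensorFeature, RKHS.kerFun_apply, RKHS.OfKernel.kernel_ofKernel]
  simp [tensorKernelOp]

lemma inner_tensorFeature {m : Fin d → ℕ} (X Y : CPTensor d r m) :
    inner ℝ (tensorFeature κ X) (tensorFeature κ Y) = tensorKernel κ X Y := by
  rw [← apply_eq_inner_kerFun, tensorFeature_apply]

lemma norm_tensorFeature_le {Kmax : ℝ}
    (hK : ∀ (m : Fin d → ℕ) (X Y : CPTensor d r m), tensorKernel κ X Y ≤ Kmax ^ 2)
    {m : Fin d → ℕ} (X : CPTensor d r m) : ‖tensorFeature κ X‖ ≤ |Kmax| := by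
  refine abs_le_of_sq_le_sq' ?_ (abs_nonneg _) |>.2
  rw [← real_inner_self_eq_norm_sq, inner_tensorFeature, sq_abs]
  exact hK m X X

lemma abs_tensorKernel_le {Kmax : ℝ}
    (hK : ∀ (m : Fin d → ℕ) (X Y : CPTensor d r m), tensorKernel κ X Y ≤ Kmax ^ 2)
    {m : Fin d → ℕ} (X Y : CPTensor d r m) : |tensorKernel κ X Y| ≤ Kmax ^ 2 := by
  rw [← inner_tensorFeature, ← sq_abs Kmax, sq]
  exact (abs_real_inner_le_norm _ _).trans (mul_le_mul (norm_tensorFeature_le hK X)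
    (norm_tensorFeature_le hK Y) (norm_nonneg _) (abs_nonneg _))

lemma continuous_tensorFeature (hκ : ∀ j, ContinuousOn (κ j).h (κ j).form.domain)
    (m : Fin d → ℕ) : Continuous fun X : CPTensor d r m => tensorFeature κ X :=
  continuous_kerFun_of_continuous_inner inner_tensorFeature (continuous_tensorKernel hκ m)

lemma exists_norm_sub_sum_tensorFeature_lt {m : Fin d → ℕ} (f : TensorRKHS r κ m) {ε : ℝ}
    (hε : 0 < ε) : ∃ c : CPTensor d r m →₀ ℝ,
      ‖f - c.sum fun X a => a • tensorFeature κ X‖ < ε := by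
  have hle : Submodule.span ℝ {RKHS.kerFun (TensorRKHS r κ m) x v | (x) (v)} ≤
      Submodule.span ℝ (Set.range fun X : CPTensor d r m => tensorFeature κ X) := by
    refine Submodule.span_le.2 ?_
    rintro _ ⟨x, v, rfl⟩
    have : RKHS.kerFun (TensorRKHS r κ m) x v = v • tensorFeature κ x := by
      rw [tensorFeature, ← map_smul, smul_eq_mul, mul_one]
    rw [this]
    exact Submodule.smul_mem _ _ (Submodule.subset_span ⟨x, rfl⟩)
  have hf : f ∈ closure (Submodule.span ℝ
      (Set.range fun X : CPTensor d r m => tensorFeature κ X) : Set (TensorRKHS r κ m)) := by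
    refine closure_mono hle ?_
    have : f ∈ (Submodule.span ℝ
        {RKHS.kerFun (TensorRKHS r κ m) x v | (x) (v)}).topologicalClosure := by
      rw [RKHS.kerFun_dense]; trivial
    exact this
  obtain ⟨g, hg, hfg⟩ := Metric.mem_closure_iff.1 hf ε hε
  obtain ⟨c, rfl⟩ := Finsupp.mem_span_range_iff_exists_finsupp.1 hg
  exact ⟨c, by rwa [← dist_eq_norm]⟩

/-- The function `∑ c(Z) K(T Z, ·)` of the reproducing kernel Hilbert space. -/
noncomputable abbrev kernelExpansion (κ : Fin d → ModeKernel) {I m : Fin d → ℕ}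
    (c : CPTensor d r I →₀ ℝ)
    (T : CPTensor d r I → CPTensor d r m) : TensorRKHS r κ m :=
  c.sum fun Z a => a • tensorFeature κ (T Z)

lemma kernelExpansion_apply {I m : Fin d → ℕ} (c : CPTensor d r I →₀ ℝ)
    (T : CPTensor d r I → CPTensor d r m) (X : CPTensor d r m) :
    kernelExpansion κ c T X = ∑ Z ∈ c.support, c Z * tensorKernel κ X (T Z) := by
  rw [apply_eq_inner_kerFun, kernelExpansion, Finsupp.sum, inner_sum]
  refine Finset.sum_congr rfl fun Z _ => ?_
  rw [real_inner_smul_right, inner_tensorFeature]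

lemma norm_kernelExpansion_le {Kmax : ℝ}
    (hK : ∀ (m : Fin d → ℕ) (X Y : CPTensor d r m), tensorKernel κ X Y ≤ Kmax ^ 2)
    {I m : Fin d → ℕ} (c : CPTensor d r I →₀ ℝ) (T : CPTensor d r I → CPTensor d r m) :
    ‖kernelExpansion κ c T‖ ≤ ∑ Z ∈ c.support, |c Z| * |Kmax| := by
  refine (norm_sum_le _ _).trans (Finset.sum_le_sum fun Z _ => ?_)
  rw [norm_smul, Real.norm_eq_abs]
  exact mul_le_mul_of_nonneg_left (norm_tensorFeature_le hK _) (abs_nonneg _)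

end TensorKernel

/-! ### Gaussian random projections -/

section Gaussian

instance isProbabilityMeasure_gaussianProj (d : ℕ) (I P : Fin d → ℕ) :
    IsProbabilityMeasure (gaussianProj d I P) := by
  unfold gaussianProj
  infer_instance

lemma memLp_inner_mul_inner_gaussian {m : ℕ} (x y : EuclideanSpace ℝ (Fin m)) :
    MemLp (fun a : Fin m → ℝ => inner ℝ x (WithLp.toLp 2 a) * inner ℝ y (WithLp.toLp 2 a)) 2
      (Measure.pi fun _ : Fin m => gaussianReal 0 1) := by
  have h4 : ∀ v : EuclideanSpace ℝ (Fin m), MemLp (fun a => inner ℝ v a) 4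
      (stdGaussian (EuclideanSpace ℝ (Fin m))) := fun v =>
    (innerSL ℝ v).comp_memLp' (IsGaussian.memLp_id _ 4 (by simp))
  have : ENNReal.HolderTriple 4 4 2 := ⟨by
    rw [← ENNReal.toReal_eq_toReal_iff' (by simp) (by simp), ENNReal.toReal_add (by simp) (by simp)]
    simp only [ENNReal.toReal_inv, ENNReal.toReal_ofNat]
    norm_num⟩
  have h2 := (h4 y).mul (r := 2) (h4 x)
  rw [← map_pi_eq_stdGaussian] at h2
  exact h2.comp_of_map (by fun_prop)

lemma integral_inner_mul_inner_gaussian {m : ℕ} (x y : EuclideanSpace ℝ (Fin m)) :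
    ∫ a : Fin m → ℝ, inner ℝ x (WithLp.toLp 2 a) * inner ℝ y (WithLp.toLp 2 a)
      ∂(Measure.pi fun _ : Fin m => gaussianReal 0 1) = inner ℝ x y := by
  have h := covarianceBilin_apply (μ := stdGaussian (EuclideanSpace ℝ (Fin m)))
    IsGaussian.memLp_two_id x y
  rw [covarianceBilin_stdGaussian] at h
  have h0 : ∫ x : EuclideanSpace ℝ (Fin m), x ∂stdGaussian (EuclideanSpace ℝ (Fin m)) = 0 :=
    integral_id_stdGaussian
  simp only [id_eq, h0, sub_zero] at h
  refine Eq.trans ?_ h.symm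
  rw [← map_pi_eq_stdGaussian, integral_map (by fun_prop) (by fun_prop)]

/-- The vector `A x / √p`. -/
noncomputable def projVec {p m : ℕ} (A : Fin p → Fin m → ℝ) (x : EuclideanSpace ℝ (Fin m)) :
    EuclideanSpace ℝ (Fin p) :=
  (√(p : ℝ))⁻¹ • WithLp.toLp 2 ((Matrix.of A).mulVec x.ofLp)

lemma projVec_sub {p m : ℕ} (A : Fin p → Fin m → ℝ) (x y : EuclideanSpace ℝ (Fin m)) :
    projVec A (x - y) = projVec A x - projVec A y := by
  simp only [projVec, WithLp.ofLp_sub, Matrix.mulVec_sub, WithLp.toLp_sub, smul_sub]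

lemma inner_projVec {p m : ℕ} (A : Fin p → Fin m → ℝ) (x y : EuclideanSpace ℝ (Fin m)) :
    inner ℝ (projVec A x) (projVec A y) = (p : ℝ)⁻¹ * ∑ q,
      inner ℝ x (WithLp.toLp 2 (A q)) * inner ℝ y (WithLp.toLp 2 (A q)) := by
  rw [projVec, projVec, real_inner_smul_left, real_inner_smul_right, ← mul_assoc, ← mul_inv,
    Real.mul_self_sqrt (Nat.cast_nonneg p)]
  congr 1
  simp [PiLp.inner_apply, Matrix.mulVec, dotProduct, mul_comm]

lemma exists_measure_inner_projVec_le {m : ℕ} (x y : EuclideanSpace ℝ (Fin m)) :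
    ∃ V : ℝ, ∀ (p : ℕ) (θ : ℝ), 0 < p → 0 < θ →
      (Measure.pi fun _ : Fin p => Measure.pi fun _ : Fin m => gaussianReal 0 1)
        {A | θ ≤ |inner ℝ (projVec A x) (projVec A y) - inner ℝ x y|} ≤
      ENNReal.ofReal (V / θ ^ 2 * (p : ℝ)⁻¹) := by
  set γ := Measure.pi fun _ : Fin m => gaussianReal 0 1 with hγ
  set u : (Fin m → ℝ) → ℝ := fun a =>
    inner ℝ x (WithLp.toLp 2 a) * inner ℝ y (WithLp.toLp 2 a) with hu
  have hu2 : MemLp u 2 γ := memLp_inner_mul_inner_gaussian x y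
  refine ⟨Var[u; γ], fun p θ hp hθ => ?_⟩
  have hp' : (p : ℝ) ≠ 0 := Nat.cast_ne_zero.2 hp.ne'
  have hq : ∀ q : Fin p, MemLp (fun A : Fin p → Fin m → ℝ => u (A q)) 2
      (Measure.pi fun _ : Fin p => γ) := fun q =>
    hu2.comp_measurePreserving (measurePreserving_eval (fun _ : Fin p => γ) q)
  set U : (Fin p → Fin m → ℝ) → ℝ := fun A => (p : ℝ)⁻¹ * ∑ q, u (A q) with hU
  have hsum : MemLp (fun A : Fin p → Fin m → ℝ => ∑ q, u (A q)) 2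
      (Measure.pi fun _ : Fin p => γ) := memLp_finsetSum _ fun q _ => hq q
  have hmean : ∫ A, U A ∂(Measure.pi fun _ : Fin p => γ) = inner ℝ x y := by
    rw [hU, integral_const_mul, integral_finsetSum _ fun q _ => (hq q).integrable (by norm_num)]
    have : ∀ q : Fin p, ∫ A : Fin p → Fin m → ℝ, u (A q) ∂(Measure.pi fun _ : Fin p => γ) =
        inner ℝ x y := fun q => by
      rw [integral_comp_eval (i := q) (μ := fun _ : Fin p => γ) hu2.1]
      exact integral_inner_mul_inner_gaussian x y
    simp only [this, Finset.sum_const, Finset.card_univ, Fintype.card_fin, nsmul_eq_mul]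
    field_simp
  have hvar : Var[U; Measure.pi fun _ : Fin p => γ] = Var[u; γ] * (p : ℝ)⁻¹ := by
    rw [hU, variance_const_mul]
    have h := variance_sum_pi (μ := fun _ : Fin p => γ) (X := fun _ => u) fun _ => hu2
    have hfun : (∑ q : Fin p, fun A : Fin p → Fin m → ℝ => u (A q)) = fun A => ∑ q, u (A q) := by
      ext A; simp
    rw [hfun] at h
    rw [h]
    simp only [Finset.sum_const, Finset.card_univ, Fintype.card_fin, nsmul_eq_mul]
    field_simp
  have hcheb := meas_ge_le_variance_div_sq (hsum.const_mul (p : ℝ)⁻¹) hθ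
  rw [show (fun A : Fin p → Fin m → ℝ => (p : ℝ)⁻¹ * ∑ q, u (A q)) = U from rfl, hmean, hvar]
    at hcheb
  simp only [inner_projVec]
  refine hcheb.trans (le_of_eq ?_)
  congr 1
  ring

lemma tendsto_measure_arg_project {d r : ℕ} {I : Fin d → ℕ} {P : ℕ → Fin d → ℕ}
    (hP : ∀ j, Tendsto (fun n => P n j) atTop atTop) (s : KernelForm) (X Y : CPTensor d r I)
    (j : Fin d) (k l : Fin r) {θ : ℝ} (hθ : 0 < θ) :
    Tendsto (fun n => gaussianProj d I (P n) {A | θ ≤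
      |s.arg (project A X j k) (project A Y j l) - s.arg (X j k) (Y j l)|}) atTop (𝓝 0) := by
  have hproj : ∀ (p : Fin d → ℕ) (A : ProjMatrices d I p) (Z : CPTensor d r I) (i : Fin r),
      project A Z j i = projVec (A j) (Z j i) := fun _ _ _ _ => rfl
  obtain ⟨x, y, hxy⟩ : ∃ x y : EuclideanSpace ℝ (Fin (I j)),
      ∀ (p : Fin d → ℕ) (A : ProjMatrices d I p),
        s.arg (project A X j k) (project A Y j l) - s.arg (X j k) (Y j l) =
          inner ℝ (projVec (A j) x) (projVec (A j) y) - inner ℝ x y := by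
    cases s with
    | radial =>
      refine ⟨X j k - Y j l, X j k - Y j l, fun p A => ?_⟩
      simp only [KernelForm.arg, hproj, ← projVec_sub, real_inner_self_eq_norm_sq]
    | dot => exact ⟨X j k, Y j l, fun p A => rfl⟩
  simp only [hxy]
  obtain ⟨V, hV⟩ := exists_measure_inner_projVec_le x y
  have hlim : Tendsto (fun n => ENNReal.ofReal (V / θ ^ 2 * (P n j : ℝ)⁻¹)) atTop (𝓝 0) := by
    have h1 : Tendsto (fun n => ((P n j : ℕ) : ℝ)⁻¹) atTop (𝓝 0) :=
      tendsto_inv_atTop_zero.comp (tendsto_natCast_atTop_atTop.comp (hP j))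
    simpa using ENNReal.tendsto_ofReal (h1.const_mul (V / θ ^ 2))
  refine tendsto_of_tendsto_of_tendsto_of_le_of_le' tendsto_const_nhds hlim
    (Eventually.of_forall fun _ => zero_le) ?_
  filter_upwards [(hP j).eventually_gt_atTop 0] with n hn
  refine le_trans (le_of_eq ?_) (hV (P n j) θ hn hθ)
  refine (measurePreserving_eval (fun j : Fin d => Measure.pi fun _ : Fin (P n j) =>
    Measure.pi fun _ : Fin (I j) => gaussianReal 0 1) j).measure_preimage
    (s := {B | θ ≤ |inner ℝ (projVec B x) (projVec B y) - inner ℝ x y|}) ?_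
  refine (measurableSet_le measurable_const (Measurable.abs ?_)).nullMeasurableSet
  simp only [inner_projVec]
  fun_prop

lemma continuous_project (d r : ℕ) (I P : Fin d → ℕ) :
    Continuous fun p : ProjMatrices d I P × CPTensor d r I => project p.1 p.2 := by
  refine continuous_pi fun j => continuous_pi fun k => ?_
  have h1 : Continuous fun p : ProjMatrices d I P × CPTensor d r I => Matrix.of (p.1 j) :=
    (continuous_apply (A := fun j => Fin (P j) → Fin (I j) → ℝ) j).comp continuous_fst
  have h2 : Continuous fun p : ProjMatrices d I P × CPTensor d r I => (p.2 j k).ofLp := by fun_prop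
  exact ((PiLp.continuous_toLp 2 _).comp (h1.matrix_mulVec h2)).const_smul (√(P j : ℝ))⁻¹

lemma tendsto_lintegral_abs_tensorKernel_project {d r : ℕ} {κ : Fin d → ModeKernel}
    (hκ : ∀ j, ContinuousOn (κ j).h (κ j).form.domain) {Kmax : ℝ}
    (hK : ∀ (m : Fin d → ℕ) (X Y : CPTensor d r m), tensorKernel κ X Y ≤ Kmax ^ 2)
    {I : Fin d → ℕ} {P : ℕ → Fin d → ℕ} (hP : ∀ j, Tendsto (fun n => P n j) atTop atTop)
    (X Y : CPTensor d r I) :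
    Tendsto (fun n => ∫⁻ A, ENNReal.ofReal
      |tensorKernel κ (project A X) (project A Y) - tensorKernel κ X Y| ∂gaussianProj d I (P n))
      atTop (𝓝 0) := by
  obtain ⟨G, hG, hG'⟩ := exists_continuous_tensorKernel_eq (r := r) hκ
  rw [ENNReal.tendsto_nhds_zero]
  intro ε hε
  obtain ⟨τ, hτ0, hτ⟩ := ENNReal.lt_iff_exists_real_btwn.1 (ENNReal.half_pos hε.ne')
  have hτpos : 0 < τ := ENNReal.ofReal_pos.1 hτ.1
  obtain ⟨θ, hθ, hcont⟩ := Metric.continuous_iff.1 hG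
    (fun j k l => (κ j).form.arg (X j k) (Y j l)) τ hτpos
  set bad : ∀ n, Fin d → Fin r → Fin r → Set (ProjMatrices d I (P n)) := fun n j k l => {A | θ ≤
    |(κ j).form.arg (project A X j k) (project A Y j l) - (κ j).form.arg (X j k) (Y j l)|}
    with hbad
  have hbadm : ∀ n j k l, MeasurableSet (bad n j k l) := fun n j k l => by
    refine measurableSet_le measurable_const (Continuous.measurable ?_)
    have h1 : ∀ Z : CPTensor d r I, ∀ i, Continuous fun A : ProjMatrices d I (P n) =>
        project A Z j i := fun Z i => (continuous_apply i).comp ((continuous_apply j).comp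
      ((continuous_project d r I (P n)).comp (continuous_id.prodMk continuous_const)))
    exact ((((κ j).form.continuous_arg _).comp ((h1 X k).prodMk (h1 Y l))).sub
      continuous_const).abs
  have hpt : ∀ n (A : ProjMatrices d I (P n)), ENNReal.ofReal
      |tensorKernel κ (project A X) (project A Y) - tensorKernel κ X Y| ≤ ENNReal.ofReal τ +
      ENNReal.ofReal (2 * Kmax ^ 2) * ∑ j, ∑ k, ∑ l, (bad n j k l).indicator 1 A := fun n A => by
    by_cases hA : ∃ j k l, A ∈ bad n j k l
    · obtain ⟨j, k, l, hjkl⟩ := hA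
      refine le_add_left ?_
      have h1 : (1 : ℝ≥0∞) ≤ ∑ j, ∑ k, ∑ l, (bad n j k l).indicator 1 A := by
        calc (1 : ℝ≥0∞) = (bad n j k l).indicator 1 A := by simp [hjkl]
          _ ≤ ∑ l, (bad n j k l).indicator 1 A :=
            Finset.single_le_sum (f := fun l => (bad n j k l).indicator (1 : ProjMatrices d I (P n) → ℝ≥0∞) A)
              (fun _ _ => zero_le) (Finset.mem_univ l)
          _ ≤ ∑ k, ∑ l, (bad n j k l).indicator 1 A :=
            Finset.single_le_sum (f := fun k => ∑ l, (bad n j k l).indicator (1 : ProjMatrices d I (P n) → ℝ≥0∞) A)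
              (fun _ _ => zero_le) (Finset.mem_univ k)
          _ ≤ _ := Finset.single_le_sum
              (f := fun j => ∑ k, ∑ l, (bad n j k l).indicator (1 : ProjMatrices d I (P n) → ℝ≥0∞) A)
              (fun _ _ => zero_le) (Finset.mem_univ j)
      refine le_trans ?_ (mul_le_mul_right h1 _)
      rw [mul_one]
      refine ENNReal.ofReal_le_ofReal ((abs_sub _ _).trans ?_)
      linarith [abs_tensorKernel_le hK (project A X) (project A Y), abs_tensorKernel_le hK X Y]
    · refine le_add_right (ENNReal.ofReal_le_ofReal ?_)
      rw [hG', hG', ← Real.dist_eq]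
      refine (hcont _ ?_).le
      push Not at hA
      simp only [dist_pi_lt_iff hθ, Real.dist_eq]
      exact fun j k l => not_le.1 (hA j k l)
  have hint : ∀ n, ∫⁻ A, ENNReal.ofReal
      |tensorKernel κ (project A X) (project A Y) - tensorKernel κ X Y| ∂gaussianProj d I (P n) ≤
      ENNReal.ofReal τ + ENNReal.ofReal (2 * Kmax ^ 2) *
        ∑ j, ∑ k, ∑ l, gaussianProj d I (P n) (bad n j k l) := fun n => by
    have hi : ∀ j k l, Measurable ((bad n j k l).indicator (1 : ProjMatrices d I (P n) → ℝ≥0∞)) := fun j k l =>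
      measurable_one.indicator (hbadm n j k l)
    refine (lintegral_mono (hpt n)).trans (le_of_eq ?_)
    rw [lintegral_add_left measurable_const, lintegral_const_mul _ (by fun_prop), lintegral_const,
      measure_univ, mul_one, lintegral_finsetSum _ (by fun_prop)]
    congr 2
    refine Finset.sum_congr rfl fun j _ => ?_
    rw [lintegral_finsetSum _ (by fun_prop)]
    refine Finset.sum_congr rfl fun k _ => ?_
    rw [lintegral_finsetSum _ (by fun_prop)]
    exact Finset.sum_congr rfl fun l _ => lintegral_indicator_one (hbadm n j k l)
  have hlim : Tendsto (fun n => ENNReal.ofReal (2 * Kmax ^ 2) *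
      ∑ j, ∑ k, ∑ l, gaussianProj d I (P n) (bad n j k l)) atTop (𝓝 0) := by
    have h := tendsto_finsetSum Finset.univ fun j (_ : j ∈ Finset.univ) =>
      tendsto_finsetSum Finset.univ fun k (_ : k ∈ Finset.univ) =>
        tendsto_finsetSum Finset.univ fun l (_ : l ∈ Finset.univ) =>
          tendsto_measure_arg_project hP (κ j).form X Y j k l hθ
    simp only [Finset.sum_const_zero] at h
    simpa only [mul_zero] using ENNReal.Tendsto.const_mul h
      (Or.inr (ENNReal.ofReal_ne_top (r := 2 * Kmax ^ 2)))
  filter_upwards [ENNReal.tendsto_nhds_zero.1 hlim _ (ENNReal.half_pos hε.ne')] with n hn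
  exact (hint n).trans ((add_le_add hτ.2.le hn).trans (ENNReal.add_halves ε).le)

end Gaussian

/-! ### The risk of the random projection based support tensor machine -/

lemma tendsto_atTop_of_projection_rate {d : ℕ} {q : ℝ} (hq : 0 < q) {lam ε : ℕ → ℝ}
    (hlam : ∀ n, 0 < lam n) (hlam0 : Tendsto lam atTop (𝓝 0)) (hε : ∀ n, 0 < ε n)
    (hεlam : Tendsto (fun n => ε n / lam n ^ q) atTop (𝓝 0)) {δ₁ : ℝ} (hδ₁ : 0 < δ₁) {P : ℕ → ℕ}
    (hP : (fun n : ℕ => Real.log (n / δ₁) ^ (1 / (d : ℝ)) / ε n ^ 2) =O[atTop]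
      fun n => (P n : ℝ)) : Tendsto P atTop atTop := by
  have hε0 : Tendsto ε atTop (𝓝 0) := by
    have h1 : Tendsto (fun n => lam n ^ q) atTop (𝓝 0) := by
      simpa [Real.zero_rpow hq.ne'] using hlam0.rpow_const (p := q) (Or.inr hq.le)
    have h2 := hεlam.mul h1
    rw [mul_zero] at h2
    exact h2.congr fun n => div_mul_cancel₀ _ (Real.rpow_pos_of_pos (hlam n) q).ne'
  have hinv : Tendsto (fun n => (ε n ^ 2)⁻¹) atTop atTop := by
    refine Tendsto.inv_tendsto_nhdsGT_zero (tendsto_nhdsWithin_iff.2 ⟨?_, ?_⟩)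
    · simpa using hε0.pow 2
    · exact Eventually.of_forall fun n => pow_pos (hε n) 2
  have hlog : ∀ᶠ n : ℕ in atTop, 1 ≤ Real.log (n / δ₁) :=
    (Real.tendsto_log_atTop.comp (tendsto_natCast_atTop_atTop.atTop_div_const hδ₁)).eventually_ge_atTop
      1
  obtain ⟨C, hC, hCP⟩ := hP.exists_pos
  have hle : ∀ᶠ n in atTop, C⁻¹ * (ε n ^ 2)⁻¹ ≤ (P n : ℝ) := by
    filter_upwards [hlog, hCP.bound] with n h1 h2
    rw [Real.norm_eq_abs, Real.norm_natCast] at h2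
    have h3 : (ε n ^ 2)⁻¹ ≤ Real.log (n / δ₁) ^ (1 / (d : ℝ)) / ε n ^ 2 := by
      rw [div_eq_mul_inv]
      refine le_mul_of_one_le_left (inv_nonneg.2 (sq_nonneg _)) ?_
      exact Real.one_le_rpow h1 (by positivity)
    rw [inv_mul_le_iff₀ hC]
    exact (h3.trans (le_abs_self _)).trans h2
  exact tendsto_natCast_atTop_iff.1
    (tendsto_atTop_mono' _ hle (hinv.const_mul_atTop (inv_pos.2 hC)))

lemma risk_le_add_lintegral {X : Type*} [MeasurableSpace X] (L : MarginLoss) (μ : Measure (X × ℝ))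
    (hlabel : ∀ᵐ z ∂μ, |z.2| = 1) {f g : X → ℝ} {M : ℝ} (hf : ∀ x, |f x| ≤ M)
    (hg : ∀ x, |g x| ≤ M) (hfm : Measurable f) :
    risk L μ g ≤ risk L μ f + ∫⁻ z, ENNReal.ofReal (2 * (1 + M) * |g z.1 - f z.1|) ∂μ := by
  have hm : Measurable fun z : X × ℝ => ENNReal.ofReal (L.eval z.2 (f z.1)) :=
    (L.measurable_eval measurable_snd (hfm.comp measurable_fst)).ennreal_ofReal
  unfold risk
  rw [← lintegral_add_left hm]
  refine lintegral_mono_ae (hlabel.mono fun z hz => ?_)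
  rw [← ENNReal.ofReal_add (L.eval_nonneg _ _) ((abs_nonneg _).trans
    (L.abs_eval_sub_le hz (hg z.1) (hf z.1)))]
  refine ENNReal.ofReal_le_ofReal ?_
  linarith [le_abs_self (L.eval z.2 (g z.1) - L.eval z.2 (f z.1)),
    L.abs_eval_sub_le hz (hg z.1) (hf z.1)]

lemma continuous_apply₂ {α β γ ω : Type*} [TopologicalSpace α] [TopologicalSpace β]
    [TopologicalSpace γ] [TopologicalSpace ω] {F : α → β → γ}
    (hF : Continuous fun p : α × β => F p.1 p.2) {a : ω → α} {b : ω → β} (ha : Continuous a)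
    (hb : Continuous b) : Continuous fun w => F (a w) (b w) :=
  hF.comp (ha.prodMk hb)

lemma measurable_apply₃ {α β γ δ ω : Type*} [MeasurableSpace α] [MeasurableSpace β]
    [MeasurableSpace γ] [MeasurableSpace δ] [MeasurableSpace ω] {F : α → β → γ → δ}
    (hF : Measurable fun p : (α × β) × γ => F p.1.1 p.1.2 p.2) {a : ω → α} {b : ω → β} {c : ω → γ}
    (ha : Measurable a) (hb : Measurable b) (hc : Measurable c) :
    Measurable fun w => F (a w) (b w) (c w) :=
  hF.comp ((ha.prodMk hb).prodMk hc)

lemma continuous_regERM_comp {X H : Type*} [NormedAddCommGroup H] [InnerProductSpace ℝ H]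
    [RKHS ℝ H X ℝ] [CompleteSpace H] [TopologicalSpace X]
    (hΦ : Continuous fun x : X => RKHS.kerFun H x (1 : ℝ)) (L : MarginLoss) {lam : ℝ}
    (hlam : 0 < lam) {n : ℕ} {ω : Type*} [TopologicalSpace ω] {S : ω → Fin n → X × ℝ} {x : ω → X}
    (hS : Continuous S) (hx : Continuous x) : Continuous fun w => regERM H L lam (S w) (x w) :=
  continuous_apply₂ (F := fun (S : Fin n → X × ℝ) x => regERM H L lam S x)
    (continuous_regERM_apply hΦ L hlam n) hS hx

lemma measurable_of_continuous_prod {α β γ : Type*} [TopologicalSpace α] [MeasurableSpace α]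
    [BorelSpace α] [TopologicalSpace β] [MeasurableSpace β] [BorelSpace β] [TopologicalSpace γ]
    [MeasurableSpace γ] [BorelSpace γ] [SecondCountableTopology β] {f : α × β → γ}
    (hf : Continuous f) : Measurable f :=
  hf.measurable

lemma measurable_of_continuous_prod_prod {α β γ δ : Type*} [TopologicalSpace α]
    [MeasurableSpace α] [BorelSpace α] [TopologicalSpace β] [MeasurableSpace β] [BorelSpace β]
    [TopologicalSpace γ] [MeasurableSpace γ] [BorelSpace γ] [TopologicalSpace δ]
    [MeasurableSpace δ] [BorelSpace δ] [SecondCountableTopology β] [SecondCountableTopology γ]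
    {f : (α × β) × γ → δ} (hf : Continuous f) : Measurable f :=
  hf.measurable

section RPSTM

variable {d r : ℕ} {I : Fin d → ℕ} {κ : Fin d → ModeKernel}

lemma measurable_tensorRKHS (hκ : ∀ j, ContinuousOn (κ j).h (κ j).form.domain) {m : Fin d → ℕ}
    (f : TensorRKHS r κ m) : Measurable fun X => f X := by
  simp only [apply_eq_inner_kerFun]
  exact ((continuous_tensorFeature hκ m).inner continuous_const).measurable

lemma continuous_rpstm (hκ : ∀ j, ContinuousOn (κ j).h (κ j).form.domain) (L : MarginLoss)
    {lam : ℝ} (hlam : 0 < lam) (n : ℕ) (P : Fin d → ℕ) :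
    Continuous fun p : ((Fin n → CPTensor d r I × ℝ) × ProjMatrices d I P) × CPTensor d r I =>
      rpstm κ L lam p.1.1 p.1.2 p.2 := by
  have hA := continuous_project d r I P
  have h1 : Continuous fun p : ((Fin n → CPTensor d r I × ℝ) × ProjMatrices d I P) ×
      CPTensor d r I => p.1.2 := continuous_snd.comp continuous_fst
  have h2 : ∀ i, Continuous fun p : ((Fin n → CPTensor d r I × ℝ) × ProjMatrices d I P) ×
      CPTensor d r I => p.1.1 i := fun i =>
    (continuous_apply i).comp (continuous_fst.comp continuous_fst)
  have hS : Continuous fun p : ((Fin n → CPTensor d r I × ℝ) × ProjMatrices d I P) ×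
      CPTensor d r I => fun i => (project p.1.2 (p.1.1 i).1, (p.1.1 i).2) :=
    continuous_pi fun i =>
      (continuous_apply₂ (F := project) hA h1 (h2 i).fst).prodMk (h2 i).snd
  have hX : Continuous fun p : ((Fin n → CPTensor d r I × ℝ) × ProjMatrices d I P) ×
      CPTensor d r I => project p.1.2 p.2 :=
    continuous_apply₂ (F := project) hA h1 continuous_snd
  exact continuous_regERM_comp (continuous_tensorFeature hκ P) L hlam hS hX

lemma measurable_rpstm (hκ : ∀ j, ContinuousOn (κ j).h (κ j).form.domain) (L : MarginLoss)
    {lam : ℝ} (hlam : 0 < lam) (n : ℕ) (P : Fin d → ℕ) :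
    Measurable fun p : ((Fin n → CPTensor d r I × ℝ) × ProjMatrices d I P) × CPTensor d r I =>
      rpstm κ L lam p.1.1 p.1.2 p.2 :=
  measurable_of_continuous_prod_prod (continuous_rpstm hκ L hlam n P)

lemma measurable_rpstm_apply (hκ : ∀ j, ContinuousOn (κ j).h (κ j).form.domain) (L : MarginLoss)
    {lam : ℝ} (hlam : 0 < lam) {n : ℕ} {P : Fin d → ℕ} (S : Fin n → CPTensor d r I × ℝ)
    (A : ProjMatrices d I P) : Measurable (rpstm κ L lam S A) :=
  measurable_apply₃ (F := rpstm κ L lam) (measurable_rpstm hκ L hlam n P) measurable_const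
    measurable_const measurable_id

variable {μ : Measure (CPTensor d r I × ℝ)} [IsProbabilityMeasure μ]

lemma measurable_risk_rpstm (hκ : ∀ j, ContinuousOn (κ j).h (κ j).form.domain) (L : MarginLoss)
    {lam : ℝ} (hlam : 0 < lam) (n : ℕ) (P : Fin d → ℕ) :
    Measurable fun p : (Fin n → CPTensor d r I × ℝ) × ProjMatrices d I P =>
      risk L μ (rpstm κ L lam p.1 p.2) := by
  have h : Measurable fun q : ((Fin n → CPTensor d r I × ℝ) × ProjMatrices d I P) ×
      (CPTensor d r I × ℝ) => ENNReal.ofReal (L.eval q.2.2 (rpstm κ L lam q.1.1 q.1.2 q.2.1)) :=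
    (L.measurable_eval (measurable_snd.comp measurable_snd)
      (measurable_apply₃ (F := rpstm κ L lam) (measurable_rpstm hκ L hlam n P)
        (measurable_fst.comp measurable_fst) (measurable_snd.comp measurable_fst)
        (measurable_fst.comp measurable_snd))).ennreal_ofReal
  exact h.lintegral_prod_right'

lemma lintegral_risk_rpstm_le (hκ : ∀ j, ContinuousOn (κ j).h (κ j).form.domain) {Kmax : ℝ}
    (hK : ∀ (m : Fin d → ℕ) (X Y : CPTensor d r m), tensorKernel κ X Y ≤ Kmax ^ 2)
    (hlabel : ∀ᵐ z ∂μ, |z.2| = 1) (L : MarginLoss) {lam : ℝ} (hlam : 0 < lam) {n : ℕ} (hn : 0 < n)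
    {P : Fin d → ℕ} (A : ProjMatrices d I P) (g : TensorRKHS r κ P) :
    ∫⁻ S, risk L μ (rpstm κ L lam S A) ∂(Measure.pi fun _ : Fin n => μ) ≤
      risk L μ (fun X => g (project A X)) +
        ENNReal.ofReal (lam * ‖g‖ ^ 2 + stabilityBound |Kmax| lam n) := by
  have hm : Measurable fun p : (Fin n → CPTensor d r I × ℝ) × CPTensor d r I =>
      rpstm κ L lam p.1 A p.2 :=
    measurable_apply₃ (F := rpstm κ L lam) (measurable_rpstm hκ L hlam n P) measurable_fst
      measurable_const measurable_snd
  have hg : Measurable fun X => g (project A X) :=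
    (measurable_tensorRKHS hκ g).comp (continuous_apply₂ (F := project)
      (continuous_project d r I P) continuous_const continuous_id).measurable
  exact lintegral_risk_regERM_le μ hlabel (project A) L hlam hn (abs_nonneg Kmax)
    (norm_tensorFeature_le hK) hm g hg

lemma measurable_tensorKernel_project_sub (hκ : ∀ j, ContinuousOn (κ j).h (κ j).form.domain)
    (P : Fin d → ℕ) (Z : CPTensor d r I) :
    Measurable fun p : ProjMatrices d I P × CPTensor d r I =>
      tensorKernel κ (project p.1 p.2) (project p.1 Z) - tensorKernel κ p.2 Z := by
  have hA := continuous_project d r I P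
  have h1 : Continuous fun p : ProjMatrices d I P × CPTensor d r I => project p.1 Z :=
    continuous_apply₂ (F := project) hA continuous_fst continuous_const
  have h2 : Continuous fun p : ProjMatrices d I P × CPTensor d r I =>
      tensorKernel κ (project p.1 p.2) (project p.1 Z) :=
    continuous_apply₂ (F := tensorKernel κ) (continuous_tensorKernel hκ P) hA h1
  have h3 : Continuous fun p : ProjMatrices d I P × CPTensor d r I => tensorKernel κ p.2 Z :=
    continuous_apply₂ (F := tensorKernel κ) (continuous_tensorKernel hκ I) continuous_snd
      continuous_const
  exact measurable_of_continuous_prod (h2.sub h3)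

lemma tendsto_lintegral_lintegral_abs_tensorKernel
    (hκ : ∀ j, ContinuousOn (κ j).h (κ j).form.domain) {Kmax : ℝ}
    (hK : ∀ (m : Fin d → ℕ) (X Y : CPTensor d r m), tensorKernel κ X Y ≤ Kmax ^ 2)
    {P : ℕ → Fin d → ℕ} (hP : ∀ j, Tendsto (fun n => P n j) atTop atTop) (Z : CPTensor d r I) :
    Tendsto (fun n => ∫⁻ A, ∫⁻ z, ENNReal.ofReal
      |tensorKernel κ (project A z.1) (project A Z) - tensorKernel κ z.1 Z| ∂μ
      ∂gaussianProj d I (P n)) atTop (𝓝 0) := by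
  have hm : ∀ n, Measurable fun p : ProjMatrices d I (P n) × (CPTensor d r I × ℝ) =>
      ENNReal.ofReal |tensorKernel κ (project p.1 p.2.1) (project p.1 Z) -
        tensorKernel κ p.2.1 Z| := fun n =>
    ((measurable_tensorKernel_project_sub hκ (P n) Z).comp
      (measurable_fst.prodMk (measurable_fst.comp measurable_snd))).abs.ennreal_ofReal
  have hswap : ∀ n, ∫⁻ A, ∫⁻ z, ENNReal.ofReal
      |tensorKernel κ (project A z.1) (project A Z) - tensorKernel κ z.1 Z| ∂μ
      ∂gaussianProj d I (P n) = ∫⁻ z, ∫⁻ A, ENNReal.ofReal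
      |tensorKernel κ (project A z.1) (project A Z) - tensorKernel κ z.1 Z|
      ∂gaussianProj d I (P n) ∂μ := fun n => lintegral_lintegral_swap (hm n).aemeasurable
  simp only [hswap]
  have h := tendsto_lintegral_of_dominated_convergence (μ := μ)
    (F := fun n z => ∫⁻ A, ENNReal.ofReal
      |tensorKernel κ (project A z.1) (project A Z) - tensorKernel κ z.1 Z|
      ∂gaussianProj d I (P n)) (f := fun _ => 0)
    (fun _ => ENNReal.ofReal (2 * Kmax ^ 2)) (fun n => (hm n).lintegral_prod_left') ?_ ?_ ?_
  · simpa using h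
  · refine fun n => Eventually.of_forall fun z => ?_
    refine (lintegral_mono (g := fun _ => ENNReal.ofReal (2 * Kmax ^ 2)) fun A =>
      ENNReal.ofReal_le_ofReal ?_).trans (by simp)
    refine (abs_sub _ _).trans ?_
    linarith [abs_tensorKernel_le hK (project A z.1) (project A Z), abs_tensorKernel_le hK z.1 Z]
  · rw [lintegral_const, measure_univ, mul_one]
    exact ENNReal.ofReal_ne_top
  · exact Eventually.of_forall fun z =>
      tendsto_lintegral_abs_tensorKernel_project hκ hK hP z.1 Z

omit [IsProbabilityMeasure μ] in
lemma risk_kernelExpansion_project_le (hκ : ∀ j, ContinuousOn (κ j).h (κ j).form.domain) {Kmax : ℝ}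
    (hK : ∀ (m : Fin d → ℕ) (X Y : CPTensor d r m), tensorKernel κ X Y ≤ Kmax ^ 2)
    (hlabel : ∀ᵐ z ∂μ, |z.2| = 1) (L : MarginLoss) (c : CPTensor d r I →₀ ℝ) {N : ℝ}
    (hN : ∑ Z ∈ c.support, |c Z| * |Kmax| ≤ N) {P : Fin d → ℕ} (A : ProjMatrices d I P) :
    risk L μ (fun X => kernelExpansion κ c (project A) (project A X)) ≤
      risk L μ (fun X => kernelExpansion κ c id X) + ∑ Z ∈ c.support,
        ENNReal.ofReal (2 * (1 + |Kmax| * N) * |c Z|) * ∫⁻ z, ENNReal.ofReal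
          |tensorKernel κ (project A z.1) (project A Z) - tensorKernel κ z.1 Z| ∂μ := by
  have hb : ∀ {m : Fin d → ℕ} (T : CPTensor d r I → CPTensor d r m) (X : CPTensor d r m),
      |kernelExpansion κ c T X| ≤ |Kmax| * N := fun T X =>
    (abs_apply_le_of_norm_kerFun_le (norm_tensorFeature_le hK) _ X).trans
      (mul_le_mul_of_nonneg_left ((norm_kernelExpansion_le hK c T).trans hN) (abs_nonneg _))
  have hN0 : 0 ≤ N := (Finset.sum_nonneg fun Z _ => by positivity).trans hN
  refine (risk_le_add_lintegral L μ hlabel (hb id) (fun X => hb (project A) (project A X))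
    (measurable_tensorRKHS hκ _)).trans ?_
  gcongr
  have hm : ∀ Z, Measurable fun z : CPTensor d r I × ℝ => ENNReal.ofReal
      |tensorKernel κ (project A z.1) (project A Z) - tensorKernel κ z.1 Z| := fun Z =>
    ((measurable_tensorKernel_project_sub hκ P Z).comp
      (measurable_const.prodMk measurable_fst)).abs.ennreal_ofReal
  simp only [← lintegral_const_mul _ (hm _)]
  rw [← lintegral_finsetSum _ fun Z _ => (hm Z).const_mul _]
  refine lintegral_mono fun z => ?_
  simp only [← ENNReal.ofReal_mul (show 0 ≤ 2 * (1 + |Kmax| * N) * |c _| by positivity)]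
  rw [← ENNReal.ofReal_sum_of_nonneg fun Z _ => by positivity]
  refine ENNReal.ofReal_le_ofReal ?_
  simp only [kernelExpansion_apply, id_eq, ← Finset.sum_sub_distrib, ← mul_sub, mul_assoc]
  rw [← Finset.mul_sum, ← Finset.mul_sum]
  have := Finset.abs_sum_le_sum_abs (fun Z => c Z * (tensorKernel κ (project A z.1) (project A Z) -
    tensorKernel κ z.1 Z)) c.support
  simp only [abs_mul] at this
  gcongr

lemma exists_risk_kernelExpansion_le (hκ : ∀ j, ContinuousOn (κ j).h (κ j).form.domain) {Kmax : ℝ}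
    (hK : ∀ (m : Fin d → ℕ) (X Y : CPTensor d r m), tensorKernel κ X Y ≤ Kmax ^ 2)
    (hlabel : ∀ᵐ z ∂μ, |z.2| = 1) (L : MarginLoss) {cη η : ℝ} (hη : 0 < η)
    (hD : ∀ lam : ℝ, 0 < lam →
      approxError (TensorRKHS r κ I) L μ lam ≤ ENNReal.ofReal (cη * lam ^ η))
    {δ : ℝ≥0∞} (hδ : 0 < δ) :
    ∃ c : CPTensor d r I →₀ ℝ,
      risk L μ (fun X => kernelExpansion κ c id X) ≤ bayesLossRisk L μ + δ := by
  obtain ⟨f, hf⟩ : ∃ f : TensorRKHS r κ I, risk L μ f ≤ bayesLossRisk L μ + δ / 2 := by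
    have hlim : Tendsto (fun t : ℝ => ENNReal.ofReal (cη * t ^ η)) (𝓝[>] 0) (𝓝 0) := by
      have h1 : Tendsto (fun t : ℝ => t ^ η) (𝓝[>] 0) (𝓝 0) := by
        have := (Real.continuousAt_rpow_const 0 η (Or.inr hη.le)).tendsto
        rw [Real.zero_rpow hη.ne'] at this
        exact this.mono_left nhdsWithin_le_nhds
      simpa using ENNReal.tendsto_ofReal (h1.const_mul cη)
    obtain ⟨t, ht, ht0⟩ := ((hlim.eventually_lt_const (ENNReal.half_pos hδ.ne')).and
      self_mem_nhdsWithin).exists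
    obtain ⟨f, hf⟩ := iInf_lt_iff.1 ((hD t ht0).trans_lt ht)
    exact ⟨f, tsub_le_iff_left.1 (le_self_add.trans hf.le)⟩
  obtain ⟨τ, hτ0, hτ⟩ := ENNReal.lt_iff_exists_real_btwn.1 (ENNReal.half_pos hδ.ne')
  have hτpos : 0 < τ := ENNReal.ofReal_pos.1 hτ.1
  set M : ℝ := |Kmax| * (‖f‖ + 1) with hM
  have hM0 : 0 ≤ M := by positivity
  set a : ℝ := 2 * (1 + M) * (|Kmax| + 1) with ha
  have ha0 : 0 < a := by positivity
  obtain ⟨c, hc⟩ := exists_norm_sub_sum_tensorFeature_lt f (lt_min one_pos (div_pos hτpos ha0))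
  refine ⟨c, ?_⟩
  set g : TensorRKHS r κ I := kernelExpansion κ c id with hg
  have hfg : ‖g - f‖ < min 1 (τ / a) := by rw [norm_sub_rev]; exact hc
  have hgn : ‖g‖ ≤ ‖f‖ + 1 := by
    have := norm_le_norm_add_norm_sub f g
    rw [norm_sub_rev] at this
    linarith [hfg.trans_le (min_le_left _ _)]
  have hbd := fun (u : TensorRKHS r κ I) X =>
    abs_apply_le_of_norm_kerFun_le (norm_tensorFeature_le hK) u X
  have h1 := risk_le_add_lintegral L μ hlabel (f := f) (g := g) (M := M)
    (fun X => (hbd f X).trans (mul_le_mul_of_nonneg_left (by linarith) (abs_nonneg _)))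
    (fun X => (hbd g X).trans (mul_le_mul_of_nonneg_left hgn (abs_nonneg _)))
    (measurable_tensorRKHS hκ f)
  have h2 : ∫⁻ z, ENNReal.ofReal (2 * (1 + M) * |g z.1 - f z.1|) ∂μ ≤ δ / 2 := by
    refine (lintegral_mono (g := fun _ => ENNReal.ofReal τ) fun z =>
      ENNReal.ofReal_le_ofReal ?_).trans (by simpa using hτ.2.le)
    have h3 : |g z.1 - f z.1| ≤ |Kmax| * ‖g - f‖ := by
      have := hbd (g - f) z.1
      rwa [RKHS.coe_sub, Pi.sub_apply] at this
    calc 2 * (1 + M) * |g z.1 - f z.1| ≤ 2 * (1 + M) * ((|Kmax| + 1) * (τ / a)) := by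
          refine mul_le_mul_of_nonneg_left (h3.trans ?_) (by positivity)
          exact mul_le_mul (by linarith) (hfg.le.trans (min_le_right _ _)) (norm_nonneg _)
            (by positivity)
      _ = τ := by rw [← mul_assoc, ← ha]; field_simp
  calc risk L μ g ≤ bayesLossRisk L μ + δ / 2 + δ / 2 := h1.trans (add_le_add hf h2)
    _ = _ := by rw [add_assoc, ENNReal.add_halves]

lemma eventually_lintegral_risk_rpstm_le (hκ : ∀ j, ContinuousOn (κ j).h (κ j).form.domain)
    {Kmax : ℝ} (hK : ∀ (m : Fin d → ℕ) (X Y : CPTensor d r m), tensorKernel κ X Y ≤ Kmax ^ 2)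
    (hlabel : ∀ᵐ z ∂μ, |z.2| = 1) (L : MarginLoss) {cη η : ℝ} (hη : 0 < η)
    (hD : ∀ lam : ℝ, 0 < lam →
      approxError (TensorRKHS r κ I) L μ lam ≤ ENNReal.ofReal (cη * lam ^ η))
    {lam : ℕ → ℝ} (hlam : ∀ n, 0 < lam n) (hlam0 : Tendsto lam atTop (𝓝 0))
    (hnlam : Tendsto (fun n : ℕ => (n : ℝ) * lam n ^ 2) atTop atTop)
    {P : ℕ → Fin d → ℕ} (hP : ∀ j, Tendsto (fun n => P n j) atTop atTop)
    {δ : ℝ≥0∞} (hδ : 0 < δ) :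
    ∀ᶠ n in atTop, ∫⁻ S, ∫⁻ A, risk L μ (rpstm κ L (lam n) S A) ∂gaussianProj d I (P n)
      ∂(Measure.pi fun _ : Fin n => μ) ≤ bayesLossRisk L μ + δ := by
  obtain ⟨c, hc⟩ := exists_risk_kernelExpansion_le (r := r) hκ hK hlabel L hη hD
    (ENNReal.half_pos hδ.ne')
  set N := ∑ Z ∈ c.support, |c Z| * |Kmax| with hN
  set D : ∀ n, CPTensor d r I → ProjMatrices d I (P n) → ℝ≥0∞ := fun n Z A =>
    ∫⁻ z, ENNReal.ofReal
      |tensorKernel κ (project A z.1) (project A Z) - tensorKernel κ z.1 Z| ∂μ with hDdef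
  set e : ℕ → ℝ≥0∞ := fun n => ∑ Z ∈ c.support,
    ENNReal.ofReal (2 * (1 + |Kmax| * N) * |c Z|) * ∫⁻ A, D n Z A ∂gaussianProj d I (P n) with he
  set s : ℕ → ℝ≥0∞ := fun n =>
    ENNReal.ofReal (lam n * N ^ 2 + stabilityBound |Kmax| (lam n) n) with hs
  have hDm : ∀ n Z, Measurable (D n Z) := fun n Z => by
    have : Measurable fun p : ProjMatrices d I (P n) × (CPTensor d r I × ℝ) =>
        ENNReal.ofReal |tensorKernel κ (project p.1 p.2.1) (project p.1 Z) -
          tensorKernel κ p.2.1 Z| :=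
      ((measurable_tensorKernel_project_sub hκ (P n) Z).comp
        (measurable_fst.prodMk (measurable_fst.comp measurable_snd))).abs.ennreal_ofReal
    exact this.lintegral_prod_right'
  have he0 : Tendsto e atTop (𝓝 0) := by
    have h := tendsto_finsetSum c.support fun Z (_ : Z ∈ c.support) =>
      ENNReal.Tendsto.const_mul (tendsto_lintegral_lintegral_abs_tensorKernel (μ := μ) hκ hK hP Z)
        (Or.inr (ENNReal.ofReal_ne_top (r := 2 * (1 + |Kmax| * N) * |c Z|)))
    simpa only [mul_zero, Finset.sum_const_zero] using h
  have hs0 : Tendsto s atTop (𝓝 0) := by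
    have h1 : Tendsto (fun n => lam n * N ^ 2 +
        8 * (1 + 2 * |Kmax| ^ 2) * |Kmax| ^ 2 * ((n : ℝ) * lam n ^ 2)⁻¹) atTop (𝓝 0) := by
      simpa only [zero_mul, mul_zero, add_zero, Function.comp_apply] using (hlam0.mul_const (N ^ 2)).add
        ((tendsto_inv_atTop_zero.comp hnlam).const_mul (8 * (1 + 2 * |Kmax| ^ 2) * |Kmax| ^ 2))
    have h2 := ENNReal.tendsto_ofReal h1
    rw [ENNReal.ofReal_zero] at h2
    refine tendsto_of_tendsto_of_tendsto_of_le_of_le' tendsto_const_nhds h2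
      (Eventually.of_forall fun _ => zero_le) ?_
    filter_upwards [hlam0.eventually_le_const one_pos] with n hn
    exact ENNReal.ofReal_le_ofReal (add_le_add_right (stabilityBound_le (hlam n) hn n) _)
  have hes : Tendsto (fun n => e n + s n) atTop (𝓝 0) := by simpa using he0.add hs0
  filter_upwards [ENNReal.tendsto_nhds_zero.1 hes _ (ENNReal.half_pos hδ.ne'),
    eventually_gt_atTop 0] with n hn hn0
  rw [lintegral_lintegral_swap (measurable_risk_rpstm hκ L (hlam n) n (P n)).aemeasurable]
  calc ∫⁻ A, ∫⁻ S, risk L μ (rpstm κ L (lam n) S A) ∂(Measure.pi fun _ : Fin n => μ)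
        ∂gaussianProj d I (P n)
      ≤ ∫⁻ A, (risk L μ (fun X => kernelExpansion κ c id X) + ∑ Z ∈ c.support,
        ENNReal.ofReal (2 * (1 + |Kmax| * N) * |c Z|) * D n Z A + s n)
          ∂gaussianProj d I (P n) := by
        refine lintegral_mono fun A => ?_
        refine (lintegral_risk_rpstm_le hκ hK hlabel L (hlam n) hn0 A
          (kernelExpansion κ c (project A))).trans (add_le_add
            (risk_kernelExpansion_project_le hκ hK hlabel L c le_rfl A)
            (ENNReal.ofReal_le_ofReal ?_))
        have := norm_kernelExpansion_le hK c (project A)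
        have := (hlam n).le
        gcongr
    _ = risk L μ (fun X => kernelExpansion κ c id X) + (e n + s n) := by
        rw [lintegral_add_right _ measurable_const, lintegral_add_left measurable_const,
          lintegral_finsetSum _ fun Z _ => (hDm n Z).const_mul _]
        simp only [lintegral_const_mul _ (hDm n _), lintegral_const, measure_univ, mul_one]
        rw [add_assoc]
    _ ≤ bayesLossRisk L μ + δ / 2 + δ / 2 := add_le_add hc hn
    _ = _ := by rw [add_assoc, ENNReal.add_halves]

end RPSTM

/-! ### Calibration of the margin losses -/

/-- The label predicted by the Bayes classifier if the label `1` has conditional probability `p`. -/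
noncomputable def bayesLabel (p : ℝ) : ℝ := if 0 ≤ 2 * p - 1 then 1 else -1

lemma measurable_bayesLabel : Measurable bayesLabel :=
  Measurable.ite (measurableSet_le measurable_const (by fun_prop)) measurable_const measurable_const

namespace MarginLoss

/-- The conditional risk of the prediction `t` if the label `1` has conditional probability `p`. -/
noncomputable def condRisk (L : MarginLoss) (p t : ℝ) : ℝ :=
  p * L.eval 1 t + (1 - p) * L.eval (-1) t

/-- A minimizer of the conditional risk. -/
noncomputable def optimal (L : MarginLoss) (p : ℝ) : ℝ :=
  match L with
  | .hinge => bayesLabel p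
  | .sqHinge => 2 * p - 1

lemma measurable_optimal (L : MarginLoss) : Measurable L.optimal := by
  cases L with
  | hinge => exact measurable_bayesLabel
  | sqHinge => exact (measurable_id.const_mul 2).sub_const 1

lemma condRisk_nonneg (L : MarginLoss) {p : ℝ} (hp0 : 0 ≤ p) (hp1 : p ≤ 1) (t : ℝ) :
    0 ≤ L.condRisk p t :=
  add_nonneg (mul_nonneg hp0 (L.eval_nonneg _ _))
    (mul_nonneg (by linarith) (L.eval_nonneg _ _))

lemma condRisk_hinge_optimal {p : ℝ} :
    hinge.condRisk p (hinge.optimal p) = 1 - |2 * p - 1| := by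
  simp only [condRisk, optimal, eval, bayesLabel]
  split_ifs with h
  · rw [abs_of_nonneg h]; norm_num; ring
  · rw [abs_of_neg (not_le.1 h)]; norm_num; ring

lemma condRisk_sqHinge_optimal {p : ℝ} (hp0 : 0 ≤ p) (hp1 : p ≤ 1) :
    sqHinge.condRisk p (sqHinge.optimal p) = 1 - (2 * p - 1) ^ 2 := by
  simp only [condRisk, optimal, eval]
  rw [max_eq_right (by linarith), max_eq_right (by linarith)]
  ring

lemma condRisk_optimal_le (L : MarginLoss) {p : ℝ} (hp0 : 0 ≤ p) (hp1 : p ≤ 1) (t : ℝ) :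
    L.condRisk p (L.optimal p) ≤ L.condRisk p t := by
  have hq : 0 ≤ 1 - p := by linarith
  cases L with
  | hinge =>
    rw [condRisk_hinge_optimal]
    simp only [condRisk, eval]
    have h1 := le_max_left 0 (1 - 1 * t)
    have h2 := le_max_right 0 (1 - 1 * t)
    have h3 := le_max_left 0 (1 - -1 * t)
    have h4 := le_max_right 0 (1 - -1 * t)
    rcases abs_cases (2 * p - 1) with h | h <;> rw [h.1]
    · nlinarith [mul_nonneg hq (by linarith : 0 ≤ max 0 (1 - 1 * t) + max 0 (1 - -1 * t) - 2)]
    · nlinarith [mul_nonneg hp0 (by linarith : 0 ≤ max 0 (1 - 1 * t) + max 0 (1 - -1 * t) - 2)]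
  | sqHinge =>
    rw [condRisk_sqHinge_optimal hp0 hp1]
    simp only [condRisk, eval]
    rcases le_total t 1 with h | h
    · rcases le_total (-1) t with h' | h'
      · rw [max_eq_right (by linarith), max_eq_right (by linarith)]
        nlinarith [sq_nonneg (t - (2 * p - 1))]
      · rw [max_eq_right (by linarith), max_eq_left (by linarith)]
        nlinarith [mul_nonneg hp0 (by nlinarith : (0 : ℝ) ≤ (1 - 1 * t) ^ 2 - 4), sq_nonneg p]
    · rw [max_eq_left (by linarith), max_eq_right (by linarith)]
      nlinarith [mul_nonneg hq (by nlinarith : (0 : ℝ) ≤ (1 - -1 * t) ^ 2 - 4), sq_nonneg (1 - p)]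

lemma one_le_condRisk (L : MarginLoss) {p t : ℝ} (hp0 : 0 ≤ p) (hp1 : p ≤ 1)
    (h : (2 * p - 1) * t ≤ 0) : 1 ≤ L.condRisk p t := by
  have hq : 0 ≤ 1 - p := by linarith
  have h2 := mul_le_mul_of_nonneg_left (le_max_right 0 (1 - 1 * t)) hp0
  have h4 := mul_le_mul_of_nonneg_left (le_max_right 0 (1 - -1 * t)) hq
  cases L with
  | hinge =>
    simp only [condRisk, eval]
    linarith
  | sqHinge =>
    simp only [condRisk, eval]
    nlinarith [mul_nonneg hp0 (sq_nonneg (max 0 (1 - 1 * t) - 1)),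
      mul_nonneg hq (sq_nonneg (max 0 (1 - -1 * t) - 1))]

lemma mul_abs_add_condRisk_optimal_le (L : MarginLoss) {p t a : ℝ} (hp0 : 0 ≤ p) (hp1 : p ≤ 1)
    (ha1 : a ≤ 1) (ht : Real.sign t ≠ bayesLabel p) :
    a * |2 * p - 1| + L.condRisk p (L.optimal p) ≤ a ^ 2 + L.condRisk p t := by
  have h : (2 * p - 1) * t ≤ 0 := by
    unfold bayesLabel at ht
    split_ifs at ht with hs
    · refine mul_nonpos_of_nonneg_of_nonpos hs (not_lt.1 fun h => ht (Real.sign_of_pos h))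
    · refine mul_nonpos_of_nonpos_of_nonneg (not_le.1 hs).le
        (not_lt.1 fun h => ht (Real.sign_of_neg h))
  have h1 := L.one_le_condRisk hp0 hp1 h
  cases L with
  | hinge =>
    rw [condRisk_hinge_optimal]
    nlinarith [mul_le_mul_of_nonneg_right ha1 (abs_nonneg (2 * p - 1)), sq_nonneg a]
  | sqHinge =>
    rw [condRisk_sqHinge_optimal hp0 hp1, ← sq_abs (2 * p - 1)]
    nlinarith [sq_nonneg (a - |2 * p - 1|), sq_nonneg (a + |2 * p - 1|)]

end MarginLoss

lemma ensemble_eq_one_or {X : Type*} (γ : ℝ) {b : ℕ} (g : Fin b → X → ℝ) (x : X) :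
    ensemble γ g x = 1 ∨ ensemble γ g x = -1 := by
  unfold ensemble
  split_ifs <;> simp

lemma ensemble_eq_of_forall_sign_eq {X : Type*} {γ : ℝ} (hγ : -1 < γ) (hγ1 : γ < 1) {b : ℕ}
    (hb : 0 < b) {g : Fin b → X → ℝ} {x : X} {p : ℝ}
    (h : ∀ i, Real.sign (g i x) = bayesLabel p) : ensemble γ g x = bayesLabel p := by
  have hb' : (b : ℝ) ≠ 0 := Nat.cast_ne_zero.2 hb.ne'
  have hs : (1 / (b : ℝ)) * ∑ i, Real.sign (g i x) = bayesLabel p := by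
    simp only [h, Finset.sum_const, Finset.card_univ, Fintype.card_fin, nsmul_eq_mul]
    field_simp
  unfold ensemble
  rw [hs]
  unfold bayesLabel
  split_ifs <;> first | rfl | linarith

/-- The conditional misclassification probability of the prediction `c` if the label `1` has
conditional probability `p`. -/
noncomputable def condMisclass (p c : ℝ) : ℝ :=
  p * (if c = 1 then 0 else 1) + (1 - p) * (if c = -1 then 0 else 1)

lemma condMisclass_nonneg {p : ℝ} (hp0 : 0 ≤ p) (hp1 : p ≤ 1) (c : ℝ) : 0 ≤ condMisclass p c := by
  unfold condMisclass
  split_ifs <;> linarith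

lemma condMisclass_bayesLabel_le (p c : ℝ) :
    condMisclass p (bayesLabel p) ≤ condMisclass p c := by
  by_cases h1 : c = 1
  · subst h1
    unfold condMisclass bayesLabel
    split_ifs <;> norm_num at *
    linarith
  · unfold condMisclass bayesLabel
    split_ifs <;> norm_num at * <;> linarith

lemma condMisclass_le_add {p e : ℝ} (he : e = 1 ∨ e = -1) :
    condMisclass p e ≤ condMisclass p (bayesLabel p) + |2 * p - 1| := by
  have h1 := le_abs_self (2 * p - 1)
  have h2 := neg_abs_le (2 * p - 1)
  have h3 := abs_nonneg (2 * p - 1)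
  unfold condMisclass bayesLabel
  rcases he with rfl | rfl <;> split_ifs <;> norm_num at * <;> linarith

lemma mul_condMisclass_ensemble_le {X : Type*} (L : MarginLoss) {γ : ℝ} (hγ : -1 < γ)
    (hγ1 : γ < 1) {b : ℕ} (hb : 0 < b) (g : Fin b → X → ℝ) (x : X) {p a : ℝ} (hp0 : 0 ≤ p)
    (hp1 : p ≤ 1) (ha0 : 0 ≤ a) (ha1 : a ≤ 1) :
    a * condMisclass p (ensemble γ g x) + ∑ _i : Fin b, L.condRisk p (L.optimal p) ≤
      a * condMisclass p (bayesLabel p) + ∑ i, (a ^ 2 + L.condRisk p (g i x)) := by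
  have hterm : ∀ i, 0 ≤ a ^ 2 + L.condRisk p (g i x) - L.condRisk p (L.optimal p) := fun i => by
    linarith [L.condRisk_optimal_le hp0 hp1 (g i x), sq_nonneg a]
  have hsum : ∑ i, (a ^ 2 + L.condRisk p (g i x) - L.condRisk p (L.optimal p)) =
      ∑ i, (a ^ 2 + L.condRisk p (g i x)) - ∑ _i : Fin b, L.condRisk p (L.optimal p) :=
    Finset.sum_sub_distrib _ _
  by_cases he : ∀ i, Real.sign (g i x) = bayesLabel p
  · rw [ensemble_eq_of_forall_sign_eq hγ hγ1 hb he]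
    linarith [Finset.sum_nonneg fun i (_ : i ∈ Finset.univ) => hterm i]
  · push Not at he
    obtain ⟨i, hi⟩ := he
    have h1 := L.mul_abs_add_condRisk_optimal_le hp0 hp1 ha1 hi
    have h2 := Finset.single_le_sum (fun i _ => hterm i) (Finset.mem_univ i)
    have h3 := mul_le_mul_of_nonneg_left
      (condMisclass_le_add (p := p) (ensemble_eq_one_or γ g x)) ha0
    linarith

section Disintegration

variable {X : Type*} [MeasurableSpace X] (μ : Measure (X × ℝ)) [IsProbabilityMeasure μ]

/-- The conditional probability of the label `1`. -/
noncomputable def labelProb (x : X) : ℝ := (μ.condKernel x).real {1}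

lemma measurable_labelProb : Measurable (labelProb μ) :=
  (μ.condKernel.measurable_coe (measurableSet_singleton 1)).ennreal_toReal

lemma labelProb_nonneg (x : X) : 0 ≤ labelProb μ x := measureReal_nonneg

lemma labelProb_le_one (x : X) : labelProb μ x ≤ 1 := measureReal_le_one

variable {μ}

lemma lintegral_eq_of_ae_label {π : Measure ℝ} [IsProbabilityMeasure π]
    (h : ∀ᵐ y ∂π, y = 1 ∨ y = -1) (f : ℝ → ℝ≥0∞) :
    ∫⁻ y, f y ∂π =
      ENNReal.ofReal (π.real {1}) * f 1 + ENNReal.ofReal (1 - π.real {1}) * f (-1) := by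
  have hne : (1 : ℝ) ≠ -1 := by norm_num
  have hmem : ∀ᵐ y ∂π, y ∈ ({1} ∪ {-1} : Set ℝ) := h
  have hdisj : Disjoint ({1} : Set ℝ) {-1} := by simpa using hne
  have hone : π ({1} ∪ {-1}) = 1 := (prob_compl_eq_zero_iff
    ((measurableSet_singleton _).union (measurableSet_singleton _))).1 (mem_ae_iff.1 hmem)
  have h2 : π.real {1} + π.real {-1} = 1 := by
    rw [← measureReal_union hdisj (measurableSet_singleton _), measureReal_def, hone,
      ENNReal.toReal_one]
  have h3 : 1 - π.real {1} = π.real {-1} := by linarith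
  have h4 : ∫⁻ y, f y ∂π = ∫⁻ y in {1} ∪ {-1}, f y ∂π := by
    rw [Measure.restrict_eq_self_of_ae_mem hmem]
  rw [h4, lintegral_union (measurableSet_singleton _) hdisj, lintegral_singleton,
    lintegral_singleton, h3, ofReal_measureReal, ofReal_measureReal, mul_comm, mul_comm (f (-1))]

lemma lintegral_eq_labelProb (hlabel : ∀ᵐ z ∂μ, z.2 = 1 ∨ z.2 = -1) {F : X × ℝ → ℝ≥0∞}
    (hF : Measurable F) :
    ∫⁻ z, F z ∂μ = ∫⁻ x, (ENNReal.ofReal (labelProb μ x) * F (x, 1) +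
      ENNReal.ofReal (1 - labelProb μ x) * F (x, -1)) ∂μ.fst := by
  have hdis : μ.fst ⊗ₘ μ.condKernel = μ := μ.disintegrate μ.condKernel
  rw [← hdis] at hlabel
  conv_lhs => rw [← hdis]
  rw [Measure.lintegral_compProd hF]
  refine lintegral_congr_ae ((Measure.ae_ae_of_ae_compProd hlabel).mono fun x hx => ?_)
  exact lintegral_eq_of_ae_label hx fun y => F (x, y)

lemma risk_eq_lintegral_condRisk (hlabel : ∀ᵐ z ∂μ, z.2 = 1 ∨ z.2 = -1) (L : MarginLoss)
    {f : X → ℝ} (hf : Measurable f) :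
    risk L μ f = ∫⁻ x, ENNReal.ofReal (L.condRisk (labelProb μ x) (f x)) ∂μ.fst := by
  have hm : Measurable fun z : X × ℝ => ENNReal.ofReal (L.eval z.2 (f z.1)) :=
    (L.measurable_eval measurable_snd (hf.comp measurable_fst)).ennreal_ofReal
  unfold risk
  rw [lintegral_eq_labelProb hlabel hm]
  refine lintegral_congr fun x => ?_
  have h0 := labelProb_nonneg μ x
  have h1 : 0 ≤ 1 - labelProb μ x := sub_nonneg.2 (labelProb_le_one μ x)
  rw [← ENNReal.ofReal_mul h0, ← ENNReal.ofReal_mul h1, ← ENNReal.ofReal_add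
    (mul_nonneg h0 (L.eval_nonneg _ _)) (mul_nonneg h1 (L.eval_nonneg _ _))]
  rfl

lemma misclassRisk_eq_lintegral_condMisclass (hlabel : ∀ᵐ z ∂μ, z.2 = 1 ∨ z.2 = -1)
    {c : X → ℝ} (hc : Measurable c) :
    misclassRisk μ c = ∫⁻ x, ENNReal.ofReal (condMisclass (labelProb μ x) (c x)) ∂μ.fst := by
  have hs : MeasurableSet {z : X × ℝ | c z.1 ≠ z.2} :=
    (measurableSet_eq_fun (hc.comp measurable_fst) measurable_snd).compl
  unfold misclassRisk
  rw [← lintegral_indicator_one hs, lintegral_eq_labelProb hlabel (measurable_one.indicator hs)]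
  refine lintegral_congr fun x => ?_
  have h0 := labelProb_nonneg μ x
  have h1 : 0 ≤ 1 - labelProb μ x := sub_nonneg.2 (labelProb_le_one μ x)
  unfold condMisclass
  rw [ENNReal.ofReal_add (mul_nonneg h0 (by split_ifs <;> simp))
    (mul_nonneg h1 (by split_ifs <;> simp)), ENNReal.ofReal_mul h0, ENNReal.ofReal_mul h1]
  simp only [Set.indicator_apply, Set.mem_ofPred_eq, ne_eq, Pi.one_apply]
  congr 2 <;> split_ifs <;> simp_all

lemma measurable_condRisk (L : MarginLoss) {f : X → ℝ} (hf : Measurable f) :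
    Measurable fun x => L.condRisk (labelProb μ x) (f x) := by
  have hp := measurable_labelProb μ
  exact (hp.mul (L.measurable_eval measurable_const hf)).add
    ((measurable_const.sub hp).mul (L.measurable_eval measurable_const hf))

lemma misclassRisk_bayesLabel_le (hlabel : ∀ᵐ z ∂μ, z.2 = 1 ∨ z.2 = -1) :
    misclassRisk μ (fun x => bayesLabel (labelProb μ x)) ≤ bayesMisclassRisk μ := by
  have hbl : Measurable fun x => bayesLabel (labelProb μ x) :=
    measurable_bayesLabel.comp (measurable_labelProb μ)
  refine le_iInf₂ fun c hc => ?_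
  rw [misclassRisk_eq_lintegral_condMisclass hlabel hc,
    misclassRisk_eq_lintegral_condMisclass hlabel hbl]
  exact lintegral_mono fun x => ENNReal.ofReal_le_ofReal
    (condMisclass_bayesLabel_le _ _)

lemma measurable_ensemble {ω : Type*} [MeasurableSpace ω] (γ : ℝ) {b : ℕ} {g : Fin b → ω → ℝ}
    (hg : ∀ i, Measurable (g i)) : Measurable (ensemble γ g) := by
  have hsign : Measurable Real.sign := by
    unfold Real.sign
    exact Measurable.ite measurableSet_Iio measurable_const
      (Measurable.ite measurableSet_Ioi measurable_const measurable_const)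
  have h : Measurable fun x => (1 / (b : ℝ)) * ∑ i, Real.sign (g i x) :=
    (Finset.measurable_sum _ fun i _ => hsign.comp (hg i)).const_mul _
  exact Measurable.ite (measurableSet_le measurable_const h) measurable_const measurable_const

lemma mul_misclassRisk_ensemble_le (hlabel : ∀ᵐ z ∂μ, z.2 = 1 ∨ z.2 = -1) (L : MarginLoss)
    {γ : ℝ} (hγ : -1 < γ) (hγ1 : γ < 1) {b : ℕ} (hb : 0 < b) {g : Fin b → X → ℝ}
    (hg : ∀ i, Measurable (g i)) {a : ℝ} (ha0 : 0 ≤ a) (ha1 : a ≤ 1) :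
    ENNReal.ofReal a * misclassRisk μ (ensemble γ g) + b * bayesLossRisk L μ ≤
      ENNReal.ofReal a * bayesMisclassRisk μ + ∑ i, (ENNReal.ofReal (a ^ 2) + risk L μ (g i)) := by
  have hopt : Measurable fun x => L.optimal (labelProb μ x) :=
    L.measurable_optimal.comp (measurable_labelProb μ)
  have hbl : Measurable fun x => bayesLabel (labelProb μ x) :=
    measurable_bayesLabel.comp (measurable_labelProb μ)
  have he := measurable_ensemble γ hg
  have hmis : ∀ {c : X → ℝ}, Measurable c →
      Measurable fun x => ENNReal.ofReal (condMisclass (labelProb μ x) (c x)) := fun {c} hc => by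
    have hp := measurable_labelProb μ
    refine Measurable.ennreal_ofReal ((hp.mul (Measurable.ite ?_ measurable_const
      measurable_const)).add ((measurable_const.sub hp).mul (Measurable.ite ?_ measurable_const
      measurable_const))) <;> exact measurableSet_eq_fun hc measurable_const
  have h1 : bayesLossRisk L μ ≤ risk L μ fun x => L.optimal (labelProb μ x) := iInf₂_le _ hopt
  refine (add_le_add_right (mul_le_mul_right h1 _) _).trans (le_trans ?_
    (add_le_add_left (mul_le_mul_right (misclassRisk_bayesLabel_le hlabel) _) _))
  have hrm : ∀ {f : X → ℝ}, Measurable f →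
      Measurable fun x => ENNReal.ofReal (L.condRisk (labelProb μ x) (f x)) := fun hf =>
    (measurable_condRisk L hf).ennreal_ofReal
  have hR : ∀ i, ENNReal.ofReal (a ^ 2) + risk L μ (g i) = ∫⁻ x, (ENNReal.ofReal (a ^ 2) +
      ENNReal.ofReal (L.condRisk (labelProb μ x) (g i x))) ∂μ.fst := fun i => by
    rw [lintegral_add_left measurable_const, lintegral_const, measure_univ, mul_one,
      risk_eq_lintegral_condRisk hlabel L (hg i)]
  simp only [hR]
  rw [misclassRisk_eq_lintegral_condMisclass hlabel he,
    misclassRisk_eq_lintegral_condMisclass hlabel hbl, risk_eq_lintegral_condRisk hlabel L hopt,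
    ← lintegral_const_mul _ (hmis he), ← lintegral_const_mul _ (hmis hbl),
    ← lintegral_const_mul _ (hrm hopt), ← lintegral_add_left ((hmis he).const_mul _),
    ← lintegral_finsetSum _ fun i _ => (hrm (hg i)).const_add _,
    ← lintegral_add_left ((hmis hbl).const_mul _)]
  refine lintegral_mono fun x => ?_
  have hp0 := labelProb_nonneg μ x
  have hp1 := labelProb_le_one μ x
  have hC : ∀ t, 0 ≤ L.condRisk (labelProb μ x) t := L.condRisk_nonneg hp0 hp1
  have hM := condMisclass_nonneg hp0 hp1
  have hpt := ENNReal.ofReal_le_ofReal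
    (mul_condMisclass_ensemble_le L hγ hγ1 hb g x hp0 hp1 ha0 ha1)
  rw [ENNReal.ofReal_add (mul_nonneg ha0 (hM _)) (Finset.sum_nonneg fun _ _ => hC _),
    ENNReal.ofReal_add (mul_nonneg ha0 (hM _))
      (Finset.sum_nonneg fun _ _ => add_nonneg (sq_nonneg a) (hC _)),
    ENNReal.ofReal_mul ha0, ENNReal.ofReal_mul ha0, ENNReal.ofReal_sum_of_nonneg fun _ _ => hC _,
    ENNReal.ofReal_sum_of_nonneg fun _ _ => add_nonneg (sq_nonneg a) (hC _)] at hpt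
  simpa only [Finset.sum_const, Finset.card_univ, Fintype.card_fin, nsmul_eq_mul,
    ENNReal.ofReal_add (sq_nonneg a) (hC _)] using hpt

end Disintegration

/-! ### Consistency -/

lemma riskConsistent_of_eventually_le {S Q : ℕ → Type*} [∀ n, MeasurableSpace (S n)]
    [∀ n, MeasurableSpace (Q n)] {P : ∀ n, Measure (S n)} {G : ∀ n, Measure (Q n)}
    [∀ n, IsProbabilityMeasure (P n)] [∀ n, IsProbabilityMeasure (G n)]
    {ρ : ∀ n, S n → Q n → ℝ≥0∞} {a : ℝ≥0∞} (ha : a ≠ ∞)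
    (hm : ∀ n, Measurable fun p : S n × Q n => ρ n p.1 p.2) (hlow : ∀ n s q, a ≤ ρ n s q)
    (hup : ∀ δ : ℝ≥0∞, 0 < δ → ∀ᶠ n in atTop, ∫⁻ s, ∫⁻ q, ρ n s q ∂G n ∂P n ≤ a + δ) :
    RiskConsistent P G ρ a := by
  have hlow' : ∀ n s, a ≤ ∫⁻ q, ρ n s q ∂G n := fun n s => by
    simpa using lintegral_mono (μ := G n) (hlow n s)
  have hlow'' : ∀ n, a ≤ ∫⁻ s, ∫⁻ q, ρ n s q ∂G n ∂P n := fun n => by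
    simpa using lintegral_mono (μ := P n) (hlow' n)
  refine ⟨hm, fun δ hδ => ?_, ?_⟩
  · rcases eq_or_ne δ ∞ with rfl | hδ'
    · simp
    refine ENNReal.tendsto_nhds_zero.2 fun ε hε => ?_
    filter_upwards [hup (ε * δ) (ENNReal.mul_pos hε.ne' hδ.ne')] with n hn
    have hsub : {s | (∫⁻ q, ρ n s q ∂G n) ∉ Set.Icc (a - δ) (a + δ)} ⊆
        {s | δ ≤ (∫⁻ q, ρ n s q ∂G n) - a} := fun s hs => by
      have h1 : a + δ < ∫⁻ q, ρ n s q ∂G n := by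
        by_contra h
        exact hs ⟨tsub_le_self.trans (hlow' n s), not_lt.1 h⟩
      exact ENNReal.le_sub_of_add_le_left ha h1.le
    have hmeas : Measurable fun s => (∫⁻ q, ρ n s q ∂G n) - a :=
      (hm n).lintegral_prod_right'.sub_const a
    refine (measure_mono hsub).trans
      ((meas_ge_le_lintegral_div hmeas.aemeasurable hδ.ne' hδ').trans ?_)
    rw [lintegral_sub measurable_const (by simpa using ha) (Eventually.of_forall (hlow' n))]
    refine ENNReal.div_le_of_le_mul (tsub_le_iff_left.2 ?_)
    simpa using hn
  · refine (ENNReal.tendsto_nhds ha).2 fun δ hδ => ?_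
    filter_upwards [hup δ hδ] with n hn
    exact ⟨tsub_le_self.trans (hlow'' n), hn⟩

lemma bayesLossRisk_ne_top {X : Type*} [MeasurableSpace X] (L : MarginLoss) (μ : Measure (X × ℝ))
    [IsProbabilityMeasure μ] : bayesLossRisk L μ ≠ ∞ := by
  refine ne_top_of_le_ne_top ENNReal.one_ne_top
    ((iInf₂_le (fun _ : X => (0 : ℝ)) measurable_const).trans (le_of_eq ?_))
  simp [risk, MarginLoss.eval_zero]

lemma bayesMisclassRisk_ne_top {X : Type*} [MeasurableSpace X] (μ : Measure (X × ℝ))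
    [IsProbabilityMeasure μ] : bayesMisclassRisk μ ≠ ∞ :=
  ne_top_of_le_ne_top ENNReal.one_ne_top
    ((iInf₂_le (fun _ : X => (0 : ℝ)) measurable_const).trans prob_le_one)

lemma measurable_misclassRisk_ensemble {d r : ℕ} {I : Fin d → ℕ} {κ : Fin d → ModeKernel}
    (hκ : ∀ j, ContinuousOn (κ j).h (κ j).form.domain) (μ : Measure (CPTensor d r I × ℝ))
    [IsProbabilityMeasure μ] (L : MarginLoss) {lam : ℝ} (hlam : 0 < lam) (n : ℕ) (P : Fin d → ℕ)
    (b : ℕ) (γ : ℝ) :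
    Measurable fun p : (Fin n → CPTensor d r I × ℝ) × (Fin b → ProjMatrices d I P) =>
      misclassRisk μ (ensemble γ fun i => rpstm κ L lam p.1 (p.2 i)) := by
  let g : Fin b → ((Fin n → CPTensor d r I × ℝ) × (Fin b → ProjMatrices d I P)) ×
      (CPTensor d r I × ℝ) → ℝ := fun i w => rpstm κ L lam w.1.1 (w.1.2 i) w.2.1
  have hg : ∀ i, Measurable (g i) := fun i =>
    measurable_apply₃ (F := rpstm κ L lam) (measurable_rpstm hκ L hlam n P)
      (measurable_fst.comp measurable_fst)
      ((measurable_pi_apply i).comp (measurable_snd.comp measurable_fst))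
      (measurable_fst.comp measurable_snd)
  have hs : MeasurableSet {w | ensemble γ g w ≠ w.2.2} :=
    (measurableSet_eq_fun (measurable_ensemble γ hg) (measurable_snd.comp measurable_snd)).compl
  exact measurable_measure_prodMk_left hs

lemma lintegral_ensemble_le {Ω Q : Type*} [MeasurableSpace Ω] [MeasurableSpace Q]
    {P : Measure Ω} {G : Measure Q} [IsProbabilityMeasure P] [IsProbabilityMeasure G] {b : ℕ}
    {R : Ω → Q → ℝ≥0∞} {E : Ω → (Fin b → Q) → ℝ≥0∞} (hRm : Measurable fun p : Ω × Q => R p.1 p.2)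
    (hEm : Measurable fun p : Ω × (Fin b → Q) => E p.1 p.2) {s c u v : ℝ≥0∞}
    (h : ∀ S A, s * E S A + c ≤ u + ∑ i, (v + R S (A i))) :
    s * ∫⁻ S, ∫⁻ A, E S A ∂(Measure.pi fun _ : Fin b => G) ∂P + c ≤
      u + b * (v + ∫⁻ S, ∫⁻ A, R S A ∂G ∂P) := by
  have hRS : ∀ S, Measurable (R S) := fun S => hRm.comp measurable_prodMk_left
  have hES : ∀ S, Measurable (E S) := fun S => hEm.comp measurable_prodMk_left
  have hA : ∀ S, s * ∫⁻ A, E S A ∂(Measure.pi fun _ : Fin b => G) + c ≤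
      u + b * (v + ∫⁻ A, R S A ∂G) := fun S => by
    have h := lintegral_mono (μ := Measure.pi fun _ : Fin b => G) (h S)
    have hRi : ∀ i : Fin b, Measurable fun A : Fin b → Q => v + R S (A i) := fun i =>
      ((hRS S).comp (measurable_pi_apply i)).const_add _
    have hRint : ∀ i : Fin b, ∫⁻ A : Fin b → Q, v + R S (A i) ∂(Measure.pi fun _ : Fin b => G) =
        v + ∫⁻ A, R S A ∂G := fun i => by
      rw [lintegral_add_left measurable_const, lintegral_const, measure_univ, mul_one,
        (measurePreserving_eval (fun _ : Fin b => G) i).lintegral_comp (hRS S)]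
    rw [lintegral_add_right _ measurable_const, lintegral_const_mul _ (hES S),
      lintegral_add_left measurable_const, lintegral_finsetSum _ fun i _ => hRi i] at h
    simpa only [hRint, lintegral_const, measure_univ, mul_one, Finset.sum_const, Finset.card_univ,
      Fintype.card_fin, nsmul_eq_mul] using h
  have hS := lintegral_mono (μ := P) hA
  have hRm' : Measurable fun S => ∫⁻ A, R S A ∂G := hRm.lintegral_prod_right'
  have hEm' : Measurable fun S => ∫⁻ A, E S A ∂(Measure.pi fun _ : Fin b => G) :=
    hEm.lintegral_prod_right'
  rw [lintegral_add_right _ measurable_const, lintegral_const_mul _ hEm',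
    lintegral_add_left measurable_const, lintegral_const_mul _ (hRm'.const_add _),
    lintegral_add_left measurable_const] at hS
  simpa only [lintegral_const, measure_univ, mul_one] using hS

/-- If `a E ≤ a e + b a² + b (R - ρ)` for all small `a`, then `E → e` as `R → ρ`. -/
lemma exists_forall_le_add_of_mul_add_le {b : ℕ} (hb : 0 < b) {ρ e δ : ℝ≥0∞} (hρ : ρ ≠ ∞)
    (hδ : 0 < δ) :
    ∃ a : ℝ, 0 < a ∧ a ≤ 1 ∧ ∀ E R : ℝ≥0∞, R ≤ ρ + ENNReal.ofReal (a ^ 2) →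
      ENNReal.ofReal a * E + b * ρ ≤ ENNReal.ofReal a * e + b * (ENNReal.ofReal (a ^ 2) + R) →
      E ≤ e + δ := by
  have hb0 : (0 : ℝ) < b := Nat.cast_pos.2 hb
  obtain ⟨τ, hτ0, hτ⟩ := ENNReal.lt_iff_exists_real_btwn.1 hδ
  have hτpos : 0 < τ := ENNReal.ofReal_pos.1 hτ.1
  set a : ℝ := min 1 (τ / (2 * b)) with ha
  have ha0 : 0 < a := lt_min one_pos (by positivity)
  refine ⟨a, ha0, min_le_left _ _, fun E R hR hE => ?_⟩
  have haτ : b * (a ^ 2 + a ^ 2) ≤ a * τ := by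
    have h1 : a * (2 * b) ≤ τ := (le_div_iff₀ (by positivity)).1 (min_le_right _ _)
    nlinarith
  have hfin : (b : ℝ≥0∞) * ρ ≠ ∞ := ENNReal.mul_ne_top (ENNReal.natCast_ne_top b) hρ
  have hle : (b : ℝ≥0∞) * (ENNReal.ofReal (a ^ 2) + ENNReal.ofReal (a ^ 2)) ≤
      ENNReal.ofReal a * δ := by
    refine le_trans ?_ (mul_le_mul_right hτ.2.le _)
    rw [← ENNReal.ofReal_add (sq_nonneg a) (sq_nonneg a), ← ENNReal.ofReal_natCast,
      ← ENNReal.ofReal_mul (Nat.cast_nonneg b), ← ENNReal.ofReal_mul ha0.le]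
    exact ENNReal.ofReal_le_ofReal haτ
  have hfinal : ENNReal.ofReal a * E + b * ρ ≤ ENNReal.ofReal a * (e + δ) + b * ρ := by
    refine hE.trans ?_
    calc ENNReal.ofReal a * e + b * (ENNReal.ofReal (a ^ 2) + R)
        ≤ ENNReal.ofReal a * e + b * (ENNReal.ofReal (a ^ 2) +
          (ρ + ENNReal.ofReal (a ^ 2))) := by gcongr
      _ = ENNReal.ofReal a * e +
          b * (ENNReal.ofReal (a ^ 2) + ENNReal.ofReal (a ^ 2)) + b * ρ := by ring
      _ ≤ _ := by
        rw [mul_add (ENNReal.ofReal a)]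
        gcongr
  exact (ENNReal.mul_le_mul_iff_right (ENNReal.ofReal_pos.2 ha0).ne' ENNReal.ofReal_ne_top).1
    ((ENNReal.add_le_add_iff_right hfin).1 hfinal)

theorem mainTheorem2
    {d r : ℕ} (hd : 0 < d) (hr : 0 < r) (I : Fin d → ℕ)
    -- the law of a labelled tensor, with labels in `{-1, 1}` and bounded CP factors
    (μ : Measure (CPTensor d r I × ℝ)) [IsProbabilityMeasure μ]
    (hlabel : ∀ᵐ z ∂μ, z.2 = 1 ∨ z.2 = -1)
    (Bx : ℝ) (hBx : ∀ᵐ z ∂μ, ∀ j k, ‖z.1 j k‖ ^ 2 ≤ Bx)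
    -- the kernel: Lipschitz profiles, bounded tensor kernel
    (κ : Fin d → ModeKernel)
    (hLip : ∀ j, ∃ C : ℝ≥0, LipschitzOnWith C (κ j).h (κ j).form.domain)
    (Kmax : ℝ) (hKmax : ∀ (m : Fin d → ℕ) (X Y : CPTensor d r m), tensorKernel κ X Y ≤ Kmax ^ 2)
    -- the loss and the rate of the approximation error
    (L : MarginLoss) (cη η : ℝ) (hη : 0 < η) (hη1 : η ≤ 1)
    (hD : ∀ lam : ℝ, 0 < lam →
      approxError (TensorRKHS r κ I) L μ lam ≤ ENNReal.ofReal (cη * lam ^ η))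
    -- the regularization parameters
    (lam : ℕ → ℝ) (hlam : ∀ n, 0 < lam n) (hlam0 : Tendsto lam atTop (𝓝 0))
    (hnlam : Tendsto (fun n : ℕ => (n : ℝ) * lam n ^ 2) atTop atTop)
    -- the projection errors and the projected dimensions
    (ε : ℕ → ℝ) (hε : ∀ n, 0 < ε n)
    (hεlam : Tendsto (fun n => ε n / lam n ^ L.exponent) atTop (𝓝 0))
    (δ₁ : ℝ) (hδ₁ : 0 < δ₁) (hδ₁' : δ₁ < 1) (P : ℕ → Fin d → ℕ)
    (hP : ∀ j, (fun n : ℕ => Real.log (n / δ₁) ^ (1 / (d : ℝ)) / ε n ^ 2)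
      =O[atTop] fun n => (P n j : ℝ)) :
    RiskConsistent (fun n => Measure.pi fun _ : Fin n => μ) (fun n => gaussianProj d I (P n))
      (fun n S A => risk L μ (rpstm κ L (lam n) S A)) (bayesLossRisk L μ) ∧
    ∀ (b : ℕ) (γ : ℝ), 0 < b → -1 < γ → γ < 1 →
      RiskConsistent (fun n => Measure.pi fun _ : Fin n => μ)
        (fun n => Measure.pi fun _ : Fin b => gaussianProj d I (P n))
        (fun n S A => misclassRisk μ (ensemble γ fun i => rpstm κ L (lam n) S (A i)))
        (bayesMisclassRisk μ) := by
  have hκ : ∀ j, ContinuousOn (κ j).h (κ j).form.domain := fun j => by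
    obtain ⟨C, hC⟩ := hLip j
    exact hC.continuousOn
  have hq : 0 < L.exponent := by cases L <;> norm_num [MarginLoss.exponent]
  have hPj : ∀ j, Tendsto (fun n => P n j) atTop atTop := fun j =>
    tendsto_atTop_of_projection_rate hq hlam hlam0 hε hεlam hδ₁ (hP j)
  have habs : ∀ᵐ z ∂μ, |z.2| = 1 := hlabel.mono fun z hz => by
    rcases hz with h | h <;> simp [h]
  have hup := fun (δ : ℝ≥0∞) (hδ : 0 < δ) =>
    eventually_lintegral_risk_rpstm_le hκ hKmax habs L hη hD hlam hlam0 hnlam hPj hδ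
  refine ⟨riskConsistent_of_eventually_le (bayesLossRisk_ne_top L μ)
    (fun n => measurable_risk_rpstm hκ L (hlam n) n (P n))
    (fun n S A => iInf₂_le _ (measurable_rpstm_apply hκ L (hlam n) S A)) hup, ?_⟩
  intro b γ hb hγ hγ1
  refine riskConsistent_of_eventually_le (bayesMisclassRisk_ne_top μ)
    (fun n => measurable_misclassRisk_ensemble hκ μ L (hlam n) n (P n) b γ)
    (fun n S A => iInf₂_le _ (measurable_ensemble γ fun i =>
      measurable_rpstm_apply hκ L (hlam n) S (A i))) fun δ hδ => ?_
  obtain ⟨a, ha0, ha1, ha⟩ := exists_forall_le_add_of_mul_add_le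
    (e := bayesMisclassRisk μ) hb (bayesLossRisk_ne_top L μ) hδ
  filter_upwards [hup (ENNReal.ofReal (a ^ 2)) (ENNReal.ofReal_pos.2 (by positivity))] with n hn
  exact ha _ _ hn (lintegral_ensemble_le (measurable_risk_rpstm hκ L (hlam n) n (P n))
    (measurable_misclassRisk_ensemble hκ μ L (hlam n) n (P n) b γ)
    fun S A => mul_misclassRisk_ensemble_le hlabel L hγ hγ1 hb
      (fun i => measurable_rpstm_apply hκ L (hlam n) S (A i)) ha0.le ha1)
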